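/- Let $\mathbb F_q$ be a finite field, $A=\mathbb F_q[T]$, let $\varpi\in A$ be a monic irreducible polynomial, $\mathfrak p=(\varpi)$, let $A_{\mathfrak p}$ be the $\mathfrak p$-adic completion of $A$ and $\kappa(\mathfrak p)=A_{\mathfrak p}/\mathfrak p$ its residue field. Put \[ \Lambda=A_{\mathfrak p}\llbracket A_{\mathfrak p}^\times\rrbracket=\varprojlim_m (A_{\mathfrak p}/\mathfrak p^m)\bigl[A_{\mathfrak p}^\times/(1+\mathfrak p^m)\bigr],\qquad \Lambda_0=A_{\mathfrak p}\llbracket 1+\mathfrak p\rrbracket=\varprojlim_m (A_{\mathfrak p}/\mathfrak p^m)\bigl[(1+\mathfrak p)/(1+\mathfrak p^m)\bigr] \] with the inverse limit topologies (every term of the limits is discrete), write $[g]$ for the element of such an algebra defined by a group element $g$, and let $(\kappa(\mathfrak p)^\times)^*=\operatorname{Hom}(\kappa(\mathfrak p)^\times,A_{\mathfrak p}^\times)$. Then: (1) $\Lambda$ is a profinite ring with finitely many maximal ideals. (2) $\Lambda_0$ is a profinite local ring, and the reduction $\Lambda_0\to(A_{\mathfrak p}/\mathfrak p)[(1+\mathfrak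 p)/(1+\mathfrak p)]=\kappa(\mathfrak p)$ is surjective with kernel the maximal ideal. There is an isomorphism of topological $A_{\mathfrak p}$-algebras $\Lambda_0\cong A_{\mathfrak p}\llbracket T_1,T_2,\dots\rrbracket$ onto the ring of all formal power series in countably infinitely many variables (every monomial involving only finitely many of them), with the topology of coefficientwise $\mathfrak p$-adic convergence. (3) There is an isomorphism of topological $A_{\mathfrak p}$-algebras \[ \Lambda\;\cong\prod_{\chi\in(\kappa(\mathfrak p)^\times)^*}\Lambda_0 \] which sends $[\zeta v]$ to $(\chi(\zeta \bmod \mathfrak p)\,[v])_\chi$ for all $v\in 1+\mathfrak p$ and all $\zeta\in A_{\mathfrak p}^\times$ with $\zeta^{\#\kappa(\mathfrak p)^\times}=1$. (4) Let $\pi\colon\Lambda\to\prod_{\chi}\kappa(\mathfrak p)$ be the composite of the isomorphism in (3) with the reduction $\Lambda_0\to\kappa(\mathfrak p)$ in every component. There is a decreasing sequence of ideals $\ker\pi=I_0\supseteq I_1\supseteq I_2\supseteq\cdots$ of $\Lambda$, with $\Lambda/I_r$ finite for all $r$, which is a basis of neighbourhoods of $0$ in $\Lambda$, such that for every $r\ge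 0$ the action of $\Lambda$ on $I_r/I_{r+1}$ factors through $\pi$. -/

import Mathlib

open Polynomial

noncomputable section

namespace Iwasawa

/-! ### The Iwasawa algebra `R⟦G⟧ = lim_m (R/I^m)[G/N_m]` -/

section General

variable {R : Type*} [CommRing R] (I : Ideal R)
variable {G : Type*} [CommGroup G] (N : ℕ →o (Subgroup G)ᵒᵈ)

/-- The `m`-th subgroup of a decreasing sequence `N` of subgroups of `G`. -/
abbrev sub (m : ℕ) : Subgroup G := OrderDual.ofDual (N m)

/-- The `m`-th level `(R/I^m)[G/N_m]`. -/
abbrev Level (m : ℕ) : Type _ := MonoidAlgebra (R ⧸ I ^ m) (G ⧸ sub N m)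

/-- The projection `G/N_{m+1} → G/N_m`. -/
def quotTransition (m : ℕ) : G ⧸ sub N (m + 1) →* G ⧸ sub N m :=
  QuotientGroup.map (sub N (m + 1)) (sub N m) (MonoidHom.id G) (N.monotone (Nat.le_succ m))

/-- The transition map `(R/I^{m+1})[G/N_{m+1}] → (R/I^m)[G/N_m]`. -/
def transition (m : ℕ) : Level I N (m + 1) →ₐ[R] Level I N m :=
  (MonoidAlgebra.mapDomainAlgHom R (R ⧸ I ^ m) (quotTransition N m)).comp
    (MonoidAlgebra.mapAlgHom (G ⧸ sub N (m + 1))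
      (Ideal.Quotient.factorₐ R (Ideal.pow_le_pow_right (Nat.le_succ m))))

/-- `lim_m (R/I^m)[G/N_m]`, realised as the `R`-algebra of compatible families. -/
def iwasawaSubalgebra : Subalgebra R (∀ m, Level I N m) where
  carrier := {x | ∀ m, transition I N m (x (m + 1)) = x m}
  mul_mem' hx hy m := by simp only [Pi.mul_apply, map_mul, hx m, hy m]
  add_mem' hx hy m := by simp only [Pi.add_apply, map_add, hx m, hy m]
  algebraMap_mem' r m := by simp only [Pi.algebraMap_apply, AlgHom.commutes]

/-- The Iwasawa algebra `R⟦G⟧ = lim_m (R/I^m)[G/N_m]`. -/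
abbrev Alg : Type _ := iwasawaSubalgebra I N

/-- The projection of the Iwasawa algebra to its `m`-th level. -/
def proj (m : ℕ) : Alg I N →ₐ[R] Level I N m :=
  (Pi.evalAlgHom R (Level I N) m).comp (iwasawaSubalgebra I N).val

/-- The inverse limit topology, every level being discrete. -/
instance : TopologicalSpace (Alg I N) := ⨅ m, TopologicalSpace.induced (proj I N m) ⊥

/-- The group-like element `[g]` of the Iwasawa algebra. -/
def of (g : G) : Alg I N :=
  ⟨fun m => MonoidAlgebra.single (QuotientGroup.mk g : G ⧸ sub N m) 1, fun m => by
    simp only [transition, AlgHom.comp_apply, MonoidAlgebra.mapAlgHom_single, map_one]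
    exact MonoidAlgebra.mapDomain_single⟩

/-- The reduction `R⟦G⟧ → R/I`: project to `(R/I)[G/N_1]` and apply the augmentation. -/
def residue : Alg I N →ₐ[R] R ⧸ I :=
  (((MonoidAlgebra.lift (R ⧸ I) (R ⧸ I) (G ⧸ sub N 1) 1).restrictScalars R).comp
    (MonoidAlgebra.mapAlgHom (G ⧸ sub N 1)
      (Ideal.Quotient.factorₐ R (le_of_eq (pow_one I))))).comp (proj I N 1)

/-- The group `1 + I^m` of units of `R` congruent to `1` modulo `I^m`. -/
def oneAdd (m : ℕ) : Subgroup Rˣ :=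
  (Units.map (Ideal.Quotient.mk (I ^ m) : R →* R ⧸ I ^ m)).ker

theorem oneAdd_anti {a b : ℕ} (hab : a ≤ b) : oneAdd I b ≤ oneAdd I a := by
  intro u hu
  simp only [oneAdd, MonoidHom.mem_ker, Units.ext_iff, Units.coe_map, Units.val_one,
    MonoidHom.coe_coe] at hu ⊢
  rw [← map_one (Ideal.Quotient.mk _), Ideal.Quotient.eq] at hu ⊢
  exact Ideal.pow_le_pow_right hab hu

/-- The decreasing sequence `m ↦ 1 + I^m` of subgroups of `Rˣ`. -/
def unitFiltration : ℕ →o (Subgroup Rˣ)ᵒᵈ where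
  toFun m := OrderDual.toDual (oneAdd I m)
  monotone' _ _ hab := oneAdd_anti I hab

/-- The decreasing sequence `m ↦ (1 + I) ∩ (1 + I^m)` of subgroups of `1 + I`. -/
def oneUnitFiltration : ℕ →o (Subgroup (oneAdd I 1))ᵒᵈ where
  toFun m := OrderDual.toDual ((oneAdd I m).subgroupOf (oneAdd I 1))
  monotone' _ _ hab := fun _ hu => oneAdd_anti I hab hu

end General

/-! ### The case of `A_𝔭`, for `A = F[T]` and `𝔭 = (ϖ)` -/

section Completion

variable {F : Type*} [Field F] (ϖ : F[X])

/-- `A_𝔭`, the `𝔭`-adic completion of `A = F[T]` for `𝔭 = (ϖ)`. -/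
abbrev Ap : Type _ := AdicCompletion (Ideal.span {ϖ}) F[X]

/-- The ideal `𝔭 A_𝔭` of `A_𝔭`. -/
def pp : Ideal (Ap ϖ) := (Ideal.span {ϖ}).map (algebraMap F[X] (Ap ϖ))

/-- The `𝔭`-adic topology of `A_𝔭`. -/
instance : TopologicalSpace (Ap ϖ) := (pp ϖ).adicTopology

/-- The residue field `κ(𝔭) = A_𝔭/𝔭`. -/
abbrev Kappa : Type _ := Ap ϖ ⧸ pp ϖ

/-- Reduction of units `A_𝔭ˣ → κ(𝔭)ˣ`. -/
def unitReduction : (Ap ϖ)ˣ →* (Kappa ϖ)ˣ :=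
  Units.map (Ideal.Quotient.mk (pp ϖ) : Ap ϖ →* Kappa ϖ)

/-- The characters of `κ(𝔭)ˣ`, with values in `A_𝔭ˣ`. -/
abbrev Chars : Type _ := (Kappa ϖ)ˣ →* (Ap ϖ)ˣ

/-- `Λ = A_𝔭⟦A_𝔭ˣ⟧ = lim_m (A_𝔭/𝔭^m)[A_𝔭ˣ/(1+𝔭^m)]`. -/
abbrev Lam : Type _ := Alg (pp ϖ) (unitFiltration (pp ϖ))

/-- The group `1 + 𝔭`. -/
abbrev OneUnits : Type _ := oneAdd (pp ϖ) 1

/-- `Λ₀ = A_𝔭⟦1+𝔭⟧ = lim_m (A_𝔭/𝔭^m)[(1+𝔭)/(1+𝔭^m)]`. -/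
abbrev Lam0 : Type _ := Alg (pp ϖ) (oneUnitFiltration (pp ϖ))

/-- The group-like element `[u]` of `Λ`. -/
abbrev ofUnit (u : (Ap ϖ)ˣ) : Lam ϖ := of (pp ϖ) (unitFiltration (pp ϖ)) u

/-- The group-like element `[v]` of `Λ₀`. -/
abbrev ofOneUnit (v : OneUnits ϖ) : Lam0 ϖ := of (pp ϖ) (oneUnitFiltration (pp ϖ)) v

/-- The reduction `Λ₀ → κ(𝔭)`. -/
abbrev residue0 : Lam0 ϖ →ₐ[Ap ϖ] Kappa ϖ := residue (pp ϖ) (oneUnitFiltration (pp ϖ))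

/-- The ring homomorphism `Λ → ∏_χ κ(𝔭)` obtained from a decomposition `Λ ≅ ∏_χ Λ₀` by reducing
every component. -/
def residueProd (e : Lam ϖ ≃ₐ[Ap ϖ] (Chars ϖ → Lam0 ϖ)) : Lam ϖ →+* (Chars ϖ → Kappa ϖ) :=
  RingHom.pi fun χ =>
    ((residue0 ϖ : Lam0 ϖ →+* Kappa ϖ).comp (Pi.evalRingHom (fun _ : Chars ϖ => Lam0 ϖ) χ)).comp
      (e : Lam ϖ →+* (Chars ϖ → Lam0 ϖ))

end Completion

/-- The action of `S` on the module `M` factors through the ring homomorphism `π : S → B`. -/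
def ActsThrough {S B : Type*} [CommRing S] [CommRing B] (π : S →+* B)
    (M : Type*) [AddCommGroup M] [Module S M] : Prop :=
  ∃ ρ : B →+* Module.End S M, ∀ (x : S) (v : M), ρ (π x) v = x • v

/-- The action of `S` on the subquotient `J/J'` (for ideals `J' ≤ J`) factors through
`π : S → B`. -/
def QuotActsThrough {S B : Type*} [CommRing S] [CommRing B] (π : S →+* B) (J J' : Ideal S) : Prop :=
  ActsThrough π (J ⧸ J'.submoduleOf J)

/-- A profinite ring: a topological ring that is compact, Hausdorff and totally disconnected. -/
structure IsProfiniteRing (S : Type*) [CommRing S] [TopologicalSpace S] : Prop where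
  isTopologicalRing : IsTopologicalRing S
  compactSpace : CompactSpace S
  t2Space : T2Space S
  totallyDisconnectedSpace : TotallyDisconnectedSpace S

end Iwasawa

end

noncomputable section

namespace Iwasawa

open Topology

/-! ### Inverse limits of finite group rings and their topology -/

section General

variable {R : Type*} [CommRing R] (I : Ideal R)
variable {G : Type*} [CommGroup G] (N : ℕ →o (Subgroup G)ᵒᵈ)

/-! Everything rests on `p = 0` in `R = A_𝔭`, on explicit approximation, and on counting.

Power series. Let `t` generate `I = 𝔭`, let `Q = #κ = p^f`, and let the `a_i` lift an `𝔽_p`-basis of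
`κ`. The one-units `u_{n,i} = 1 + a_i t^n`, with `n > 0` prime to `p`, generate `1 + I` modulo every
`1 + I^m`: Frobenius is onto on `κ`, so `p^j`-th powers reach the exponents `n p^j`
(`exists_mem_closure_sub_mem`). If `n p^k ≥ m`, then `([u_{n,i}] - 1)^(p^k)` vanishes at level `m`.
Thus `T_{n,i} ↦ [u_{n,i}] - 1` maps the series truncated to a finite box of monomials onto the
level. The box has at most `Q^(m-1)` monomials (`sum_expo_le`) and `(1+I)/(1+I^m)` has at least
`Q^(m-1)` elements (`card_quot_le_mul_card_oneUnits`), so this surjection is a bijection modulo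
`I^m`. Completeness of `R` gives the limit (`exists_algEquiv_mvPowerSeries`).

Characters. The Teichmüller section splits `Rˣ` as `κˣ × (1 + I)`. Since `#κˣ = -1` in `R`,
orthogonality of characters makes the map to the product over `χ` onto at each level, and counting
makes it bijective (`levelChar_bijective`).

Filtration. `Λ₀` is local, so `M = ker π` lies in the Jacobson radical of `Λ`, and some power of `M`
lies in any given ideal of finite index. Powers of `M` beyond the first are not open, so
`exists_filtration` mixes them with the open ideals `ker (proj m)`. -/

theorem transition_single (m : ℕ) (g : G) (r : R) :
    transition I N m (MonoidAlgebra.single (QuotientGroup.mk g : G ⧸ sub N (m + 1))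
      (Ideal.Quotient.mk _ r)) =
    MonoidAlgebra.single (QuotientGroup.mk g : G ⧸ sub N m) (Ideal.Quotient.mk _ r) := by
  simp only [transition, AlgHom.comp_apply, MonoidAlgebra.mapAlgHom_single]
  exact MonoidAlgebra.mapDomain_single

theorem transition_proj (m : ℕ) (x : Alg I N) :
    transition I N m (proj I N (m + 1) x) = proj I N m x := x.2 m

variable {I N} in
theorem alg_ext {x y : Alg I N} (h : ∀ m, proj I N m x = proj I N m y) : x = y :=
  Subtype.ext (funext h)

/-- The map to the limit defined by a compatible family of algebra homomorphisms. -/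
def limLift {B : Type*} [CommRing B] [Algebra R B] (h : ∀ m, B →ₐ[R] Level I N m)
    (hc : ∀ m b, transition I N m (h (m + 1) b) = h m b) : B →ₐ[R] Alg I N :=
  (AlgHom.pi h).codRestrict (iwasawaSubalgebra I N) fun b m => hc m b

@[simp]
theorem proj_limLift {B : Type*} [CommRing B] [Algebra R B] (h : ∀ m, B →ₐ[R] Level I N m)
    (hc : ∀ m b, transition I N m (h (m + 1) b) = h m b) (m : ℕ) (b : B) :
    proj I N m (limLift I N h hc b) = h m b := rfl

theorem proj_of (m : ℕ) (g : G) :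
    proj I N m (of I N g) = MonoidAlgebra.single (QuotientGroup.mk g : G ⧸ sub N m) 1 := rfl

theorem ker_proj_antitone : Antitone fun m => RingHom.ker (proj I N m) :=
  antitone_nat_of_succ_le fun m x hx => by
    rw [RingHom.mem_ker] at hx ⊢
    rw [← transition_proj, hx, map_zero]

theorem isInducing_proj :
    @IsInducing _ _ _ (@Pi.topologicalSpace ℕ (Level I N) fun _ => ⊥)
      (fun (x : Alg I N) m => proj I N m x) :=
  @inducing_iInf_to_pi ℕ (Level I N) (fun _ => ⊥) (Alg I N) (fun m => proj I N m)

theorem nhds_zero_hasBasis :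
    (𝓝 (0 : Alg I N)).HasBasis (fun _ : ℕ => True)
      (fun m => (RingHom.ker (proj I N m) : Set (Alg I N))) := by
  have h : 𝓝 (0 : Alg I N) =
      ⨅ m, Filter.principal (RingHom.ker (proj I N m) : Set (Alg I N)) := by
    refine (nhds_iInf).trans (iInf_congr fun m => ?_)
    let _ : TopologicalSpace (Level I N m) := ⊥
    have : DiscreteTopology (Level I N m) := ⟨rfl⟩
    rw [nhds_induced, nhds_discrete, ← Filter.principal_singleton, Filter.comap_principal, map_zero]
    rfl
  rw [h]
  exact Filter.hasBasis_iInf_principal (ker_proj_antitone I N).directed_ge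

theorem alg_isTopologicalRing : IsTopologicalRing (Alg I N) := by
  let _ : ∀ m, TopologicalSpace (Level I N m) := fun _ => ⊥
  have : ∀ m, DiscreteTopology (Level I N m) := fun _ => ⟨rfl⟩
  have hi := isInducing_proj I N
  have hp : ∀ m, Continuous (proj I N m) := fun m =>
    (continuous_apply m).comp hi.continuous
  exact
    { continuous_add := hi.continuous_iff.2 <| continuous_pi fun m =>
        ((hp m).comp continuous_fst).add ((hp m).comp continuous_snd)
      continuous_mul := hi.continuous_iff.2 <| continuous_pi fun m =>
        ((hp m).comp continuous_fst).mul ((hp m).comp continuous_snd)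
      continuous_neg := hi.continuous_iff.2 <| continuous_pi fun m => (hp m).neg }

instance finite_level [∀ m, Finite (R ⧸ I ^ m)] [∀ m, Finite (G ⧸ sub N m)] (m : ℕ) :
    Finite (Level I N m) :=
  Finite.of_equiv _ (MonoidAlgebra.coeffEquiv.trans Finsupp.equivFunOnFinite).symm

/-- Compatible families form a closed subspace of a product of finite discrete spaces. -/
theorem alg_isProfiniteRing [∀ m, Finite (R ⧸ I ^ m)] [∀ m, Finite (G ⧸ sub N m)] :
    IsProfiniteRing (Alg I N) := by
  let _ : ∀ m, TopologicalSpace (Level I N m) := fun _ => ⊥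
  have : ∀ m, DiscreteTopology (Level I N m) := fun _ => ⟨rfl⟩
  have hi := isInducing_proj I N
  have hinj : Function.Injective (fun (x : Alg I N) m => proj I N m x) :=
    fun x y h => alg_ext (congrFun h)
  have hemb : IsEmbedding (fun (x : Alg I N) m => proj I N m x) := ⟨hi, hinj⟩
  have hrange : Set.range (fun (x : Alg I N) m => proj I N m x) =
      ⋂ m, {y : ∀ m, Level I N m | transition I N m (y (m + 1)) = y m} := by
    ext y
    simp only [Set.mem_range, Set.mem_iInter, Set.mem_ofPred_eq]
    constructor
    · rintro ⟨x, rfl⟩ m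
      exact x.2 m
    · intro h
      exact ⟨⟨y, h⟩, rfl⟩
  have hclosed : IsClosedEmbedding (fun (x : Alg I N) m => proj I N m x) := by
    refine ⟨hemb, ?_⟩
    rw [hrange]
    exact isClosed_iInter fun m => isClosed_eq
      (continuous_of_discreteTopology.comp (continuous_apply (m + 1))) (continuous_apply m)
  exact
    { isTopologicalRing := alg_isTopologicalRing I N
      compactSpace := hclosed.compactSpace
      t2Space := hemb.t2Space
      totallyDisconnectedSpace := hemb.isTotallyDisconnected_range.1
        (isTotallyDisconnected_of_totallyDisconnectedSpace _) }

theorem ker_proj_le_ker_residue : RingHom.ker (proj I N 1) ≤ RingHom.ker (residue I N) := by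
  intro x hx
  rw [RingHom.mem_ker] at hx ⊢
  rw [residue, AlgHom.comp_apply, hx, map_zero]

theorem residue_surjective : Function.Surjective (residue I N) := by
  intro x
  obtain ⟨r, rfl⟩ := Ideal.Quotient.mk_surjective x
  exact ⟨algebraMap R _ r, (residue I N).commutes r⟩

end General

/-! ### Evaluating power series at nilpotent families -/

section TruncEval

variable {R B σ : Type*} [CommRing R] [CommRing B] [Algebra R B]

theorem sub_one_pow_prime_pow {p : ℕ} (hp : p.Prime) (hpB : (p : B) = 0) (x : B) (k : ℕ) :
    (x - 1) ^ p ^ k = x ^ p ^ k - 1 := by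
  have h := (Commute.all (x - 1) 1).add_pow_prime_pow_eq hp k
  rw [hpB] at h
  simp only [sub_add_cancel, one_pow, zero_mul, add_zero] at h
  rw [h, add_sub_cancel_right]

/-- A polynomial whose coefficients at the monomials bounded by `d` act as zero vanishes at a
family of elements with `x i ^ (d i + 1) = 0`. -/
theorem aeval_eq_zero_of_coeff {x : σ → B} {d : σ →₀ ℕ} (hx : ∀ i, x i ^ (d i + 1) = 0)
    {P : MvPolynomial σ R} (hP : ∀ e ≤ d, algebraMap R B (P.coeff e) = 0) :
    MvPolynomial.aeval x P = 0 := by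
  rw [MvPolynomial.aeval_def, MvPolynomial.eval₂_eq]
  refine Finset.sum_eq_zero fun e _ => ?_
  by_cases he : e ≤ d
  · rw [hP e he, zero_mul]
  · obtain ⟨i, hi⟩ := not_forall.1 he
    rw [not_le] at hi
    have hmem : i ∈ e.support := by
      rw [Finsupp.mem_support_iff]
      omega
    have h0 : x i ^ e i = 0 := pow_eq_zero_of_le hi (hx i)
    rw [Finset.prod_eq_zero hmem h0, mul_zero]

theorem aeval_congr_of_coeff {x : σ → B} {d : σ →₀ ℕ} (hx : ∀ i, x i ^ (d i + 1) = 0)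
    {P P' : MvPolynomial σ R}
    (hP : ∀ e ≤ d, algebraMap R B (P.coeff e) = algebraMap R B (P'.coeff e)) :
    MvPolynomial.aeval x P = MvPolynomial.aeval x P' := by
  rw [← sub_eq_zero, ← map_sub]
  refine aeval_eq_zero_of_coeff hx fun e he => ?_
  rw [MvPolynomial.coeff_sub, map_sub, hP e he, sub_self]

open Classical in
/-- Evaluation of power series at a family of elements with `x i ^ (d i + 1) = 0`, where `d` has
finite support. -/
def truncEval (x : σ → B) (d : σ →₀ ℕ) (hx : ∀ i, x i ^ (d i + 1) = 0) :
    MvPowerSeries σ R →ₐ[R] B :=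
  AlgHom.ofLinearMap ((MvPolynomial.aeval x).toLinearMap ∘ₗ MvPowerSeries.trunc' R d)
    (by simp)
    (fun f g => by
      simp only [LinearMap.comp_apply, AlgHom.toLinearMap_apply]
      rw [← map_mul]
      -- The truncation of `f * g` and the product of the truncations agree only at monomials below
      -- `d`; all other monomials evaluate to zero.
      refine aeval_congr_of_coeff hx fun e he => ?_
      rw [MvPowerSeries.coeff_trunc', if_pos he,
        MvPowerSeries.coeff_trunc'_mul_trunc'_eq_coeff_mul d f g he])

open Classical in
theorem truncEval_apply (x : σ → B) (d : σ →₀ ℕ) (hx : ∀ i, x i ^ (d i + 1) = 0)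
    (f : MvPowerSeries σ R) :
    truncEval x d hx f = MvPolynomial.aeval x (MvPowerSeries.trunc' R d f) := rfl

theorem truncEval_congr {x : σ → B} {d : σ →₀ ℕ} (hx : ∀ i, x i ^ (d i + 1) = 0)
    {f g : MvPowerSeries σ R} (h : ∀ e ≤ d, algebraMap R B (MvPowerSeries.coeff e f) =
      algebraMap R B (MvPowerSeries.coeff e g)) :
    truncEval x d hx f = truncEval x d hx g := by
  classical
  rw [truncEval_apply, truncEval_apply]
  refine aeval_congr_of_coeff hx fun e he => ?_
  rw [MvPowerSeries.coeff_trunc', if_pos he, MvPowerSeries.coeff_trunc', if_pos he, h e he]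

theorem truncEval_X (x : σ → B) (d : σ →₀ ℕ) (hx : ∀ i, x i ^ (d i + 1) = 0) (i : σ) :
    truncEval x d hx (MvPowerSeries.X i : MvPowerSeries σ R) = x i := by
  classical
  rw [truncEval_apply, ← MvPolynomial.aeval_X (R := R) x i]
  refine aeval_congr_of_coeff hx fun e he => ?_
  rw [MvPowerSeries.coeff_trunc', if_pos he, ← MvPolynomial.coe_X, MvPolynomial.coeff_coe]

theorem map_truncEval {C : Type*} [CommRing C] [Algebra R C] (φ : B →ₐ[R] C) {x : σ → B}
    {y : σ → C} {d d' : σ →₀ ℕ} (hx : ∀ i, x i ^ (d' i + 1) = 0) (hy : ∀ i, y i ^ (d i + 1) = 0)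
    (hd : d ≤ d') (hxy : ∀ i, φ (x i) = y i) (f : MvPowerSeries σ R) :
    φ (truncEval x d' hx f) = truncEval y d hy f := by
  classical
  rw [truncEval_apply, truncEval_apply, ← AlgHom.comp_apply, MvPolynomial.comp_aeval,
    show (fun i => φ (x i)) = y from funext hxy]
  refine aeval_congr_of_coeff hy fun e he => ?_
  rw [MvPowerSeries.coeff_trunc', if_pos (he.trans hd), MvPowerSeries.coeff_trunc', if_pos he]

/-- If evaluation is onto a ring with at least as many elements as there are truncated series over
`R/J`, its kernel consists of the series whose truncation vanishes modulo `J`. -/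
theorem coeff_mem_of_truncEval_eq_zero {J : Ideal R} (hJ : ∀ r ∈ J, algebraMap R B r = 0)
    [Finite (R ⧸ J)] {x : σ → B} {d : σ →₀ ℕ} (hx : ∀ i, x i ^ (d i + 1) = 0)
    (hsurj : Function.Surjective (truncEval (R := R) x d hx))
    (hcard : Nat.card (Set.Iic d → R ⧸ J) ≤ Nat.card B) {f : MvPowerSeries σ R}
    (hf : truncEval x d hx f = 0) {e : σ →₀ ℕ} (he : e ≤ d) : MvPowerSeries.coeff e f ∈ J := by
  classical
  let Φ : MvPowerSeries σ R → (Set.Iic d → R ⧸ J) :=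
    fun g e => Ideal.Quotient.mk J (MvPowerSeries.coeff e.1 g)
  have hΦ : Function.Surjective Φ := by
    intro c
    refine ⟨fun e => if h : e ≤ d then (c ⟨e, h⟩).out else 0, funext fun e => ?_⟩
    have : MvPowerSeries.coeff e.1 (fun e => if h : e ≤ d then (c ⟨e, h⟩).out else 0 :
        MvPowerSeries σ R) = (c e).out := dif_pos e.2
    simp only [Φ, this]
    exact Quotient.out_eq _
  have hfac : ∀ g h, Φ g = Φ h → truncEval (R := R) x d hx g = truncEval x d hx h := by
    intro g h hgh
    refine truncEval_congr hx fun e he => ?_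
    rw [← sub_eq_zero, ← map_sub]
    exact hJ _ (Ideal.Quotient.eq.1 (congrFun hgh ⟨e, he⟩))
  -- Evaluation factors through the coefficients in the box modulo `J`. A surjection of finite sets
  -- whose source is no larger than its target is injective, which replaces a proof of linear
  -- independence.
  let L : (Set.Iic d → R ⧸ J) → B := fun c => truncEval x d hx (Function.surjInv hΦ c)
  have hL : ∀ g, L (Φ g) = truncEval x d hx g := fun g => hfac _ _ (Function.surjInv_eq hΦ _)
  have hLs : Function.Surjective L := fun b => by
    obtain ⟨g, rfl⟩ := hsurj b
    exact ⟨Φ g, hL g⟩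
  have : Finite (Set.Iic d) := Set.finite_Iic d
  have hLi := (hLs.bijective_of_nat_card_le hcard).1
  have h0 : Φ f = Φ 0 := hLi (by rw [hL, hL, hf, map_zero])
  have := congrFun h0 ⟨e, he⟩
  simpa [Φ, Ideal.Quotient.eq_zero_iff_mem] using this

end TruncEval

/-! ### From truncated series at each level to the power series ring -/

section PowerSeries

variable {R : Type*} [CommRing R] (I : Ideal R)
variable {G : Type*} [CommGroup G] (N : ℕ →o (Subgroup G)ᵒᵈ)

theorem algebraMap_level_eq_zero {m : ℕ} {r : R} (hr : r ∈ I ^ m) :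
    algebraMap R (Level I N m) r = 0 := by
  have : algebraMap R (R ⧸ I ^ m) r = 0 := Ideal.Quotient.eq_zero_iff_mem.2 hr
  rw [IsScalarTower.algebraMap_apply R (R ⧸ I ^ m) (Level I N m), this, map_zero]

/-- As `p = 0`, Frobenius gives `([g] - 1)^(p^k) = [g^(p^k)] - 1`. -/
theorem single_sub_one_pow_eq_zero {p : ℕ} (hp : p.Prime) (hpR : (p : R) = 0) {m k : ℕ} {g : G}
    (hg : g ^ p ^ k ∈ sub N m) :
    ((MonoidAlgebra.single (QuotientGroup.mk g : G ⧸ sub N m) 1 - 1 : Level I N m)) ^ p ^ k = 0 := by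
  have hpL : (p : Level I N m) = 0 := by
    rw [← map_natCast (algebraMap R (Level I N m)), hpR, map_zero]
  rw [sub_one_pow_prime_pow hp hpL, MonoidAlgebra.single_pow, one_pow, ← QuotientGroup.mk_pow,
    (QuotientGroup.eq_one_iff _).2 hg, MonoidAlgebra.one_def, sub_self]

theorem nat_card_level [∀ m, Finite (G ⧸ sub N m)] (m : ℕ) :
    Nat.card (Level I N m) = Nat.card (R ⧸ I ^ m) ^ Nat.card (G ⧸ sub N m) := by
  rw [Nat.card_congr (MonoidAlgebra.coeffEquiv.trans Finsupp.equivFunOnFinite), Nat.card_fun]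

/-- A subalgebra of a level that contains group elements generating the group is everything. -/
theorem level_surjective_of_closure {B : Type*} [CommRing B] [Algebra R B] {m : ℕ}
    [Finite (G ⧸ sub N m)] (φ : B →ₐ[R] Level I N m) {s : Set G}
    (hs : Subgroup.closure s ⊔ sub N m = ⊤)
    (h : ∀ g ∈ s, ∃ b, φ b = MonoidAlgebra.single (QuotientGroup.mk g : G ⧸ sub N m) 1) :
    Function.Surjective φ := by
  let T : Submonoid (G ⧸ sub N m) :=
    (MonoidHom.mrange (φ : B →* Level I N m)).comap (MonoidAlgebra.of (R ⧸ I ^ m) (G ⧸ sub N m))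
  let T' : Subgroup (G ⧸ sub N m) :=
    { T with
      inv_mem' := fun {x} hx => by
        -- In a finite group inverses are powers, so the group elements hit by `φ` form a subgroup.
        have : x⁻¹ ∈ Submonoid.powers x := by
          rw [mem_powers_iff_mem_zpowers]
          exact inv_mem (Subgroup.mem_zpowers x)
        exact Submonoid.powers_le.2 hx this }
  have hT : T'.comap (QuotientGroup.mk' (sub N m)) = ⊤ := by
    rw [eq_top_iff, ← hs, sup_le_iff, Subgroup.closure_le]
    refine ⟨fun g hg => h g hg, fun g hg => ?_⟩
    change (QuotientGroup.mk g : G ⧸ sub N m) ∈ T'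
    rw [(QuotientGroup.eq_one_iff _).2 hg]
    exact one_mem _
  intro y
  induction y using MonoidAlgebra.induction_on with
  | of g =>
    obtain ⟨g, rfl⟩ := QuotientGroup.mk_surjective g
    have : g ∈ T'.comap (QuotientGroup.mk' (sub N m)) := hT ▸ Subgroup.mem_top g
    exact this
  | add x y hx hy =>
    obtain ⟨a, rfl⟩ := hx
    obtain ⟨b, rfl⟩ := hy
    exact ⟨a + b, map_add _ _ _⟩
  | smul r x hx =>
    obtain ⟨a, rfl⟩ := hx
    obtain ⟨r, rfl⟩ := Ideal.Quotient.mk_surjective r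
    exact ⟨r • a, map_smul _ _ _⟩

open MvPowerSeries.WithPiTopology in
/-- The Iwasawa algebra of a pro-`p` group which has, at every level, a basis consisting of the
images of a fixed family `u` is a ring of formal power series over `R`, if `p = 0` in `R`. -/
theorem exists_algEquiv_mvPowerSeries [TopologicalSpace R] (hI : IsAdic I) [IsAdicComplete I R]
    [∀ m, Finite (R ⧸ I ^ m)] [∀ m, Finite (G ⧸ sub N m)]
    {p : ℕ} (hp : p.Prime) (hpR : (p : R) = 0) {σ : Type*} (u : σ → G)
    (d : ℕ → σ →₀ ℕ) (hd : Monotone d) (hdtop : ∀ i c, ∃ m, c ≤ d m i)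
    (hpow : ∀ m i, ∃ k, d m i + 1 = p ^ k ∧ u i ^ p ^ k ∈ sub N m)
    (hgen : ∀ m, Subgroup.closure (Set.range u) ⊔ sub N m = ⊤)
    (hcard : ∀ m, Nat.card (Set.Iic (d m)) ≤ Nat.card (G ⧸ sub N m)) :
    ∃ f : Alg I N ≃ₐ[R] MvPowerSeries σ R, Continuous f ∧ Continuous f.symm := by
  classical
  let x : ∀ m, σ → Level I N m := fun m i =>
    MonoidAlgebra.single (QuotientGroup.mk (u i) : G ⧸ sub N m) 1 - 1
  have hx : ∀ m i, x m i ^ (d m i + 1) = 0 := by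
    intro m i
    obtain ⟨k, hk, hu⟩ := hpow m i
    rw [hk]
    exact single_sub_one_pow_eq_zero I N hp hpR hu
  let θ : ∀ m, MvPowerSeries σ R →ₐ[R] Level I N m := fun m => truncEval (x m) (d m) (hx m)
  have hθ : ∀ m f, transition I N m (θ (m + 1) f) = θ m f := by
    intro m f
    refine map_truncEval _ _ _ (hd (Nat.le_succ m)) (fun i => ?_) f
    have := transition_single I N m (u i) 1
    simp only [map_one] at this
    simp only [x, map_sub, map_one, this]
  have hθs : ∀ m, Function.Surjective (θ m) := by
    intro m
    refine level_surjective_of_closure I N (θ m) (hgen m) ?_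
    rintro _ ⟨i, rfl⟩
    refine ⟨MvPowerSeries.X i + 1, ?_⟩
    rw [map_add, map_one]
    simp only [θ, truncEval_X, x, sub_add_cancel]
  have hker : ∀ m f, θ m f = 0 ↔ ∀ e ≤ d m, MvPowerSeries.coeff e f ∈ I ^ m := by
    intro m f
    constructor
    · intro hf e he
      refine coeff_mem_of_truncEval_eq_zero (fun r hr => algebraMap_level_eq_zero I N hr) (hx m)
        (hθs m) ?_ hf he
      have : Finite (Set.Iic (d m)) := Set.finite_Iic (d m)
      rw [nat_card_level, Nat.card_fun]
      exact Nat.pow_le_pow_right Nat.card_pos (hcard m)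
    · intro h
      rw [← map_zero (θ m)]
      refine truncEval_congr (hx m) fun e he => ?_
      rw [map_zero, map_zero]
      exact algebraMap_level_eq_zero I N (h e he)
  have hmem : ∀ e : σ →₀ ℕ, ∃ m, e ≤ d m := by
    intro e
    choose c hc using fun i => hdtop i (e i)
    refine ⟨e.support.sup c, fun i => ?_⟩
    by_cases hi : i ∈ e.support
    · exact (hc i).trans (hd (Finset.le_sup hi) i)
    · rw [Finsupp.notMem_support_iff.1 hi]
      exact Nat.zero_le _
  let ψ : MvPowerSeries σ R →ₐ[R] Alg I N := limLift I N θ hθ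
  have hinj : Function.Injective ψ := by
    rw [injective_iff_map_eq_zero]
    intro f hf
    have h0 : ∀ m, θ m f = 0 := fun m => by
      rw [← proj_limLift I N θ hθ m f]
      exact (congrArg _ hf).trans (map_zero _)
    ext e
    obtain ⟨m₀, hm₀⟩ := hmem e
    rw [MvPowerSeries.coeff_zero]
    refine IsHausdorff.haus' (I := I) _ fun n => ?_
    rw [SModEq.zero, smul_eq_mul, Ideal.mul_top]
    -- The level must be at least `n` for the precision `I^n`, and at least `m₀` for its box to
    -- contain `e`.
    exact Ideal.pow_le_pow_right (le_max_left n m₀)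
      ((hker _ _).1 (h0 (max n m₀)) e (hm₀.trans (hd (le_max_right _ _))))
  have hsurj : Function.Surjective ψ := by
    intro y
    choose g hg using fun m => hθs m (proj I N m y)
    have hgg : ∀ m n, m ≤ n → ∀ e ≤ d m,
        MvPowerSeries.coeff e (g m) - MvPowerSeries.coeff e (g n) ∈ I ^ m := by
      intro m n hmn e he
      rw [← map_sub]
      refine (hker m _).1 ?_ e he
      have h1 : ∀ f, proj I N m (ψ f) = θ m f := fun f => rfl
      have h2 : ψ (g n) - y ∈ RingHom.ker (proj I N m) := by
        refine ker_proj_antitone I N hmn ?_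
        rw [RingHom.mem_ker, map_sub, sub_eq_zero]
        exact hg n
      rw [RingHom.mem_ker, map_sub, h1, sub_eq_zero] at h2
      rw [map_sub, hg m, h2, sub_self]
    choose c hc using hmem
    have hlim : ∀ e, ∃ L : R, ∀ n, c e ≤ n → MvPowerSeries.coeff e (g n) - L ∈ I ^ n := by
      intro e
      -- The coefficients of `g n` at `e` are controlled only once `e` lies in the box `d n`, so the
      -- Cauchy sequence starts at the index `c e`.
      obtain ⟨L, hL⟩ := IsPrecomplete.prec' (I := I)
        (fun n => MvPowerSeries.coeff e (g (max n (c e)))) (by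
          intro m n hmn
          rw [SModEq.sub_mem, smul_eq_mul, Ideal.mul_top]
          refine Ideal.pow_le_pow_right (le_max_left m (c e))
            (hgg _ _ (max_le_max_right _ hmn) e ?_)
          exact (hc e).trans (hd (le_max_right _ _)))
      refine ⟨L, fun n hn => ?_⟩
      have := hL n
      rwa [SModEq.sub_mem, smul_eq_mul, Ideal.mul_top, max_eq_left hn] at this
    choose L hL using hlim
    obtain ⟨S, hS⟩ : ∃ S : MvPowerSeries σ R, ∀ e, MvPowerSeries.coeff e S = L e :=
      ⟨fun e => L e, fun e => rfl⟩
    refine ⟨S, alg_ext fun m => ?_⟩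
    change θ m _ = _
    rw [← hg m, ← sub_eq_zero, ← map_sub, hker]
    intro e he
    rw [map_sub, hS]
    -- Here `m` may be smaller than `c e`, so `g m` is compared with the limit through a later term.
    have h1 := hgg m (max m (c e)) (le_max_left _ _) e he
    have h2 := Ideal.pow_le_pow_right (le_max_left m (c e)) (hL e (max m (c e)) (le_max_right _ _))
    have h3 := neg_mem (add_mem h1 h2)
    rw [sub_add_sub_cancel, neg_sub] at h3
    exact h3
  let E := AlgEquiv.ofBijective ψ ⟨hinj, hsurj⟩
  have hψ : ∀ m f, proj I N m (E f) = θ m f := fun m f => rfl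
  have : IsTopologicalRing R := by
    rw [hI]
    exact I.adic_basis.toRing_subgroups_basis.toRingFilterBasis.isTopologicalRing
  have := alg_isTopologicalRing I N
  refine ⟨E.symm, ?_, ?_⟩
  · refine continuous_pi fun e => ?_
    let c : Alg I N →+ R := (MvPowerSeries.coeff e).toAddMonoidHom.comp E.symm.toAddMonoidHom
    refine continuous_of_continuousAt_zero c ?_
    rw [ContinuousAt, map_zero, (nhds_zero_hasBasis I N).tendsto_iff hI.hasBasis_nhds_zero]
    intro n _
    obtain ⟨m₀, hm₀⟩ := hmem e
    refine ⟨max n m₀, trivial, fun y hy => ?_⟩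
    obtain ⟨f, rfl⟩ := E.surjective y
    rw [SetLike.mem_coe, RingHom.mem_ker, hψ, hker] at hy
    have : c (E f) = MvPowerSeries.coeff e f := by
      change MvPowerSeries.coeff e (E.symm (E f)) = _
      rw [AlgEquiv.symm_apply_apply]
    rw [this]
    exact Ideal.pow_le_pow_right (le_max_left n m₀) (hy e (hm₀.trans (hd (le_max_right _ _))))
  · rw [AlgEquiv.symm_symm]
    refine continuous_of_continuousAt_zero E ?_
    rw [ContinuousAt, map_zero, (nhds_zero_hasBasis I N).tendsto_right_iff]
    intro m _
    simp only [SetLike.mem_coe, RingHom.mem_ker, hψ, hker]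
    have hfin := Set.finite_Iic (d m)
    have : ∀ e ∈ Set.Iic (d m), ∀ᶠ f : MvPowerSeries σ R in 𝓝 0,
        MvPowerSeries.coeff e f ∈ I ^ m := by
      intro e _
      have hc : Filter.Tendsto (fun f : MvPowerSeries σ R => MvPowerSeries.coeff e f) (𝓝 0) (𝓝 0) :=
        (MvPowerSeries.WithPiTopology.continuous_coeff R e).tendsto' 0 0 (map_zero _)
      exact hc.eventually (hI.hasBasis_nhds_zero.mem_of_mem trivial)
    exact (hfin.eventually_all).2 this

end PowerSeries

/-! ### The completion `A_𝔭` and its finite quotients -/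

section Completion

variable {F : Type*} [Field F] (ϖ : F[X])

theorem span_fg : (Ideal.span {ϖ}).FG := ⟨{ϖ}, by simp⟩

theorem pp_eq_span : pp ϖ = Ideal.span {algebraMap F[X] (Ap ϖ) ϖ} := by
  rw [pp, Ideal.map_span, Set.image_singleton]

instance ap_isAdicComplete : IsAdicComplete (pp ϖ) (Ap ϖ) := by
  rw [pp, IsAdicComplete.map_algebraMap_iff]
  exact AdicCompletion.isAdicComplete (span_fg ϖ)

theorem ap_isAdic : IsAdic (pp ϖ) := rfl

theorem ker_evalₐ_eq_pp_pow (n : ℕ) :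
    RingHom.ker (AdicCompletion.evalₐ (Ideal.span {ϖ}) n) = pp ϖ ^ n := by
  ext x
  have h1 : x ∈ pp ϖ ^ n ↔ x ∈ (AdicCompletion.eval (Ideal.span {ϖ}) F[X] n).ker := by
    rw [pp, ← Ideal.map_pow, ← Submodule.restrictScalars_mem F[X], ← Ideal.smul_top_eq_map,
      AdicCompletion.pow_smul_top_eq_ker_eval (span_fg ϖ)]
  rw [h1, RingHom.mem_ker, LinearMap.mem_ker,
    ← AdicCompletion.factor_eval_eq_evalₐ (Ideal.span {ϖ}) x (by simp)]
  -- The linear and the algebra evaluation maps have quotients by two expressions of the same ideal,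
  -- so they have the same kernel.
  have eq : Ideal.span {ϖ} ^ n • (⊤ : Ideal F[X]) = Ideal.span {ϖ} ^ n := by simp
  have : Function.Injective (Ideal.Quotient.factor (le_of_eq eq)) := by
    simpa [RingHom.injective_iff_ker_eq_bot, Ideal.Quotient.factor_ker]
      using Ideal.map_mk_eq_bot_of_le (le_of_eq eq.symm)
  exact map_eq_zero_iff _ this

/-- `A_𝔭/𝔭^n` is `A/𝔭^n`. -/
def quotPowEquiv (n : ℕ) : Ap ϖ ⧸ pp ϖ ^ n ≃+* F[X] ⧸ Ideal.span {ϖ} ^ n :=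
  (Ideal.quotEquivOfEq (ker_evalₐ_eq_pp_pow ϖ n).symm).trans
    (RingHom.quotientKerEquivOfSurjective (AdicCompletion.surjective_evalₐ (Ideal.span {ϖ}) n))

variable {ϖ}

theorem pp_isMaximal (hirr : Irreducible ϖ) : (pp ϖ).IsMaximal := by
  have hmax : (Ideal.span {ϖ}).IsMaximal := PrincipalIdealRing.isMaximal_of_irreducible hirr
  let _ : Field (F[X] ⧸ Ideal.span {ϖ}) := Ideal.Quotient.field _
  have h := AdicCompletion.ker_evalOneₐ_eq_map _ (span_fg ϖ)
  rw [pp, ← h]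
  exact RingHom.ker_isMaximal_of_surjective _ (AdicCompletion.evalOneₐ_surjective (Ideal.span {ϖ}))

theorem card_quot_pow (hirr : Irreducible ϖ) (n : ℕ) :
    Nat.card (Ap ϖ ⧸ pp ϖ ^ n) = Nat.card (Ap ϖ ⧸ pp ϖ) ^ n := by
  have hmax : (Ideal.span {ϖ}).IsMaximal := PrincipalIdealRing.isMaximal_of_irreducible hirr
  have hprime : (Ideal.span {ϖ}).IsPrime := hmax.isPrime
  have hbot : Ideal.span {ϖ} ≠ ⊥ := by simpa using hirr.ne_zero
  have h := cardQuot_pow_of_prime (P := Ideal.span {ϖ}) hbot (i := n)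
  have h1 : Nat.card (Ap ϖ ⧸ pp ϖ) = Nat.card (F[X] ⧸ Ideal.span {ϖ}) := by
    have := Nat.card_congr (quotPowEquiv ϖ 1).toEquiv
    rwa [pow_one, pow_one] at this
  rw [Nat.card_congr (quotPowEquiv ϖ n).toEquiv, h1]
  exact h

theorem finite_quot [Finite F] (hmonic : ϖ.Monic) : Finite (Ap ϖ ⧸ pp ϖ) := by
  have := hmonic.finite_quotient
  have hfin : Finite (F[X] ⧸ Ideal.span {ϖ}) := Module.finite_of_finite F
  have e := (quotPowEquiv ϖ 1).toEquiv
  rw [pow_one, pow_one] at e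
  exact Finite.of_equiv _ e.symm

theorem exists_prime_natCast_eq_zero [Finite F] : ∃ p : ℕ, p.Prime ∧ (p : Ap ϖ) = 0 := by
  obtain ⟨p, hp⟩ := CharP.exists F
  refine ⟨p, CharP.char_is_prime F p, ?_⟩
  rw [← map_natCast (algebraMap F (Ap ϖ)), CharP.cast_eq_zero, map_zero]

end Completion

/-! ### Generators of the one-units and the size of the box -/

section OneUnits

variable {R : Type*} [CommRing R] {I : Ideal R}

theorem mem_oneAdd {m : ℕ} {u : Rˣ} : u ∈ oneAdd I m ↔ (u : R) - 1 ∈ I ^ m := by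
  rw [oneAdd, MonoidHom.mem_ker, Units.ext_iff, ← Ideal.Quotient.eq, map_one]
  rfl

theorem mem_sub_oneUnitFiltration {m : ℕ} {u : oneAdd I 1} :
    u ∈ sub (oneUnitFiltration I) m ↔ ((u : Rˣ) : R) - 1 ∈ I ^ m := mem_oneAdd

theorem inv_mul_mem_sub_oneUnitFiltration {m : ℕ} {u v : oneAdd I 1} :
    u⁻¹ * v ∈ sub (oneUnitFiltration I) m ↔ ((v : Rˣ) : R) - ((u : Rˣ) : R) ∈ I ^ m := by
  rw [mem_sub_oneUnitFiltration, ← Ideal.unit_mul_mem_iff_mem _ (u : Rˣ).isUnit, mul_sub]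
  simp

theorem isUnit_one_add [IsAdicComplete I R] {x : R} (hx : x ∈ I) : IsUnit (1 + x) := by
  have := Ideal.mem_jacobson_bot.1 (IsAdicComplete.le_jacobson_bot I hx) 1
  rwa [mul_one, add_comm] at this

theorem exists_oneUnit [IsAdicComplete I R] {x : R} (hx : x ∈ I) :
    ∃ u : oneAdd I 1, ((u : Rˣ) : R) = 1 + x := by
  obtain ⟨u, hu⟩ := isUnit_one_add hx
  exact ⟨⟨u, by rw [mem_oneAdd, hu, add_sub_cancel_left, pow_one]; exact hx⟩, hu⟩

instance finite_quot_unitFiltration [∀ m, Finite (R ⧸ I ^ m)] (m : ℕ) :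
    Finite (Rˣ ⧸ sub (unitFiltration I) m) :=
  Finite.of_injective _ (QuotientGroup.kerLift_injective
    (Units.map (Ideal.Quotient.mk (I ^ m) : R →* R ⧸ I ^ m)))

instance finite_quot_oneUnitFiltration [∀ m, Finite (R ⧸ I ^ m)] (m : ℕ) :
    Finite (oneAdd I 1 ⧸ sub (oneUnitFiltration I) m) := by
  have h : Finite (Rˣ ⧸ oneAdd I m) := finite_quot_unitFiltration m
  have : (oneAdd I m).FiniteIndex := Subgroup.finiteIndex_of_finite_quotient
  exact Subgroup.finite_quotient_of_finiteIndex (H := (oneAdd I m).subgroupOf (oneAdd I 1))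

/-- Subtracting a fixed representative of the residue class of `y` and adding `1` gives a one-unit;
it and the residue class together recover `y` modulo `I^m`. -/
theorem card_quot_le_mul_card_oneUnits [IsAdicComplete I R] [∀ m, Finite (R ⧸ I ^ m)]
    [Finite (R ⧸ I)] (m : ℕ) :
    Nat.card (R ⧸ I ^ m) ≤ Nat.card (R ⧸ I) * Nat.card (oneAdd I 1 ⧸ sub (oneUnitFiltration I) m) := by
  rw [← Nat.card_prod]
  have hs : ∀ r : R, r - (Ideal.Quotient.mk I r).out ∈ I := fun r => by
    rw [← Ideal.Quotient.eq]
    exact (Quotient.out_eq _).symm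
  choose w hw using fun y : R ⧸ I ^ m => exists_oneUnit (hs y.out)
  refine Nat.card_le_card_of_injective
    (fun y : R ⧸ I ^ m => (Ideal.Quotient.mk I y.out, (QuotientGroup.mk (w y) :
      oneAdd I 1 ⧸ sub (oneUnitFiltration I) m))) fun y z hyz => ?_
  obtain ⟨h1, h2⟩ := Prod.ext_iff.1 hyz
  dsimp only at h1 h2
  rw [QuotientGroup.eq, inv_mul_mem_sub_oneUnitFiltration, hw, hw, h1] at h2
  have h3 : z.out - y.out ∈ I ^ m := by
    convert h2 using 1
    ring
  rw [← Ideal.Quotient.eq] at h3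
  have hout : ∀ y : R ⧸ I ^ m, Ideal.Quotient.mk (I ^ m) y.out = y := fun y => Quotient.out_eq y
  rw [← hout y, ← hout z, h3]

theorem add_pow_prime_pow {p : ℕ} (hp : p.Prime) (hpR : (p : R) = 0) (x y : R) (k : ℕ) :
    (x + y) ^ p ^ k = x ^ p ^ k + y ^ p ^ k := by
  rw [(Commute.all x y).add_pow_prime_pow_eq hp k, hpR]
  simp

/-- Because `2n ≥ n + 1`, the map `b ↦ 1 + b t^n` turns sums into products modulo `I^(n+1)`. The `b`
reached by `H` therefore form an additive monoid, which contains `I` and all `a i`. -/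
theorem exists_mem_closure_sub_mem_of_not_dvd {t : R} (hI : I = Ideal.span {t})
    {ι : Type*} [Finite ι] {a : ι → R}
    (ha : ∀ c : R, ∃ ε : ι → ℕ, c - ∑ᶠ i, ε i • a i ∈ I) {H : Subgroup (oneAdd I 1)} {n : ℕ}
    (hn : 0 < n) (hH : ∀ i, ∃ h ∈ H, ((h : Rˣ) : R) = 1 + a i * t ^ n) (b : R) :
    ∃ h ∈ H, ((h : Rˣ) : R) - (1 + b * t ^ n) ∈ I ^ (n + 1) := by
  have ht : t ∈ I := hI ▸ Ideal.mem_span_singleton_self t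
  let P : AddSubmonoid R :=
    { carrier := {b | ∃ h ∈ H, ((h : Rˣ) : R) - (1 + b * t ^ n) ∈ I ^ (n + 1)}
      zero_mem' := ⟨1, one_mem _, by simp⟩
      add_mem' := by
        rintro b c ⟨h, hh, hb⟩ ⟨k, hk, hc⟩
        refine ⟨h * k, mul_mem hh hk, ?_⟩
        have h2 : (b * t ^ n) * (c * t ^ n) ∈ I ^ (n + 1) := by
          rw [show (b * t ^ n) * (c * t ^ n) = (b * c * t ^ (n - 1)) * t ^ (n + 1) by
            obtain ⟨n, rfl⟩ := Nat.exists_eq_add_of_lt hn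
            rw [show 0 + n + 1 - 1 = n by omega]
            ring]
          exact Ideal.mul_mem_left _ _ (Ideal.pow_mem_pow ht _)
        have := add_mem (add_mem (Ideal.mul_mem_right ((k : Rˣ) : R) _ hb)
          (Ideal.mul_mem_left _ (1 + b * t ^ n) hc)) h2
        convert this using 1
        simp only [Subgroup.coe_mul, Units.val_mul]
        ring }
  have hPa : ∀ i, a i ∈ P := fun i => by
    obtain ⟨h, hh, he⟩ := hH i
    exact ⟨h, hh, by rw [he, sub_self]; exact zero_mem _⟩
  have hPI : ∀ c ∈ I, c ∈ P := fun c hc => by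
    refine ⟨1, one_mem _, ?_⟩
    have : c * t ^ n ∈ I ^ (n + 1) := by
      rw [pow_succ']
      exact Ideal.mul_mem_mul hc (Ideal.pow_mem_pow ht n)
    have := neg_mem this
    convert this using 1
    simp
  obtain ⟨ε, hε⟩ := ha b
  have : b ∈ P := by
    have h1 : ∑ᶠ i, ε i • a i ∈ P :=
      finsum_induction (· ∈ P) (zero_mem _) (fun _ _ => add_mem) fun i => nsmul_mem (hPa i) _
    have := add_mem (hPI _ hε) h1
    rwa [sub_add_cancel] at this
  exact this

/-- Write `m = p^j n` with `n` prime to `p`. Raising to the power `p^j` sends `1 + b t^n` to `1 +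
b^(p^j) t^m`, and every residue is a `p^j`-th power in the finite field `R ⧸ I`. The error, in
`I^(n+1)`, is sent into `I^(p^j (n+1))`, hence into `I^(m+1)`. -/
theorem exists_mem_closure_sub_mem {t : R} (hI : I = Ideal.span {t})
    [Finite (R ⧸ I)] [I.IsMaximal] {p : ℕ} (hp : p.Prime)
    (hpR : (p : R) = 0) {H : Subgroup (oneAdd I 1)}
    (hH : ∀ n, 0 < n → ¬ p ∣ n → ∀ b : R,
      ∃ h ∈ H, ((h : Rˣ) : R) - (1 + b * t ^ n) ∈ I ^ (n + 1))
    {m : ℕ} (hm : 0 < m) {u : R} (hu : u - 1 ∈ I ^ m) :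
    ∃ h ∈ H, ((h : Rˣ) : R) - u ∈ I ^ (m + 1) := by
  obtain ⟨j, n, hn, rfl⟩ := Nat.exists_eq_pow_mul_and_not_dvd hm.ne' p hp.ne_one
  have hn0 : 0 < n := Nat.pos_of_mul_pos_left hm
  have ht : t ∈ I := hI ▸ Ideal.mem_span_singleton_self t
  rw [hI, Ideal.span_singleton_pow, Ideal.mem_span_singleton] at hu
  obtain ⟨c, hc⟩ := hu
  have hpk : (p : R ⧸ I) = 0 := by
    rw [← map_natCast (Ideal.Quotient.mk I), hpR, map_zero]
  have : Fact p.Prime := ⟨hp⟩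
  have : CharP (R ⧸ I) p := (CharP.charP_iff_prime_eq_zero hp).2 hpk
  let _ : Field (R ⧸ I) := Ideal.Quotient.field I
  obtain ⟨b, hb⟩ : ∃ b : R, b ^ p ^ j - c ∈ I := by
    obtain ⟨b, hb⟩ := (Finite.injective_iff_surjective.1
      (iterateFrobenius_inj (R ⧸ I) p j)) (Ideal.Quotient.mk I c)
    obtain ⟨b, rfl⟩ := Ideal.Quotient.mk_surjective b
    refine ⟨b, ?_⟩
    rw [← Ideal.Quotient.eq, map_pow]
    exact hb
  obtain ⟨h, hh, hhb⟩ := hH n hn0 hn b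
  refine ⟨h ^ p ^ j, pow_mem hh _, ?_⟩
  have h1 : ((h : Rˣ) : R) ^ p ^ j = 1 + b ^ p ^ j * t ^ (p ^ j * n) +
      (((h : Rˣ) : R) - (1 + b * t ^ n)) ^ p ^ j := by
    rw [← one_pow (M := R) (p ^ j), mul_comm (p ^ j) n, pow_mul t, ← mul_pow,
      ← add_pow_prime_pow hp hpR, ← add_pow_prime_pow hp hpR, one_pow, add_sub_cancel]
  have h2 : (((h : Rˣ) : R) - (1 + b * t ^ n)) ^ p ^ j ∈ I ^ (p ^ j * n + 1) := by
    have h3 := Ideal.pow_mem_pow hhb (p ^ j)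
    rw [← pow_mul] at h3
    refine Ideal.pow_le_pow_right ?_ h3
    have := Nat.pos_of_ne_zero (pow_ne_zero j hp.ne_zero)
    nlinarith
  have h4 : (b ^ p ^ j - c) * t ^ (p ^ j * n) ∈ I ^ (p ^ j * n + 1) := by
    rw [pow_succ']
    exact Ideal.mul_mem_mul hb (Ideal.pow_mem_pow ht _)
  have := add_mem h4 h2
  convert this using 1
  rw [Subgroup.coe_pow, Units.val_pow_eq_pow_val, h1, eq_add_of_sub_eq hc]
  ring

/-- Successive approximation: an element of `1 + I^m` is corrected by an element of `H` to one of `1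
+ I^(m+1)`. Levels `0` and `1` are trivial, since the whole group is `1 + I`. -/
theorem closure_sup_sub_eq_top {H : Subgroup (oneAdd I 1)}
    (hH : ∀ m, 0 < m → ∀ u : oneAdd I 1, ((u : Rˣ) : R) - 1 ∈ I ^ m →
      ∃ h ∈ H, ((h : Rˣ) : R) - ((u : Rˣ) : R) ∈ I ^ (m + 1)) (m : ℕ) :
    H ⊔ sub (oneUnitFiltration I) m = ⊤ := by
  have hone : ∀ m ≤ 1, sub (oneUnitFiltration I) m = ⊤ := fun m hm =>
    eq_top_iff.2 fun u _ => oneAdd_anti I hm u.2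
  induction m with
  | zero => rw [hone 0 zero_le_one, sup_top_eq]
  | succ m ih =>
    rcases Nat.eq_zero_or_pos m with rfl | hm
    · rw [hone 1 le_rfl, sup_top_eq]
    · rw [eq_top_iff, ← ih, sup_le_iff]
      refine ⟨le_sup_left, fun u hu => ?_⟩
      obtain ⟨h, hh, hhu⟩ := hH m hm u (mem_sub_oneUnitFiltration.1 hu)
      have h1 := inv_mul_mem_sub_oneUnitFiltration.2 hhu
      have h2 := mul_mem (Subgroup.mem_sup_left (T := sub (oneUnitFiltration I) (m + 1)) hh)
        (Subgroup.mem_sup_right (S := H) (inv_mem h1))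
      simpa using h2

/-- The number of `j` with `n p^j < m`. -/
def expo (p n m : ℕ) : ℕ := ((Finset.range m).filter fun j => n * p ^ j < m).card

theorem expo_mono (p n : ℕ) : Monotone (expo p n) := fun a b hab =>
  Finset.card_le_card fun j hj => by
    simp only [Finset.mem_filter, Finset.mem_range] at hj ⊢
    omega

theorem le_expo {p n : ℕ} (hp : 1 < p) (hn : 0 < n) (c : ℕ) : c ≤ expo p n (n * p ^ c + 1) := by
  have : Finset.range c ⊆ (Finset.range (n * p ^ c + 1)).filter
      fun j => n * p ^ j < n * p ^ c + 1 := by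
    intro j hj
    rw [Finset.mem_range] at hj
    have h1 : n * p ^ j ≤ n * p ^ c :=
      Nat.mul_le_mul_left _ (Nat.pow_le_pow_right (by omega) hj.le)
    have h2 : c < p ^ c := Nat.lt_pow_self hp
    have h3 : p ^ c ≤ n * p ^ c := Nat.le_mul_of_pos_left _ hn
    simp only [Finset.mem_filter, Finset.mem_range]
    omega
  simpa [expo] using Finset.card_le_card this

/-- The `j` with `n p^j < m` form an initial segment, all below `m`; their number is thus the least
`k` with `n p^k ≥ m`, the exponent that kills `1 + a t^n` modulo `1 + I^m`. -/
theorem le_mul_pow_expo {p n : ℕ} (hp : 1 < p) (hn : 0 < n) (m : ℕ) : m ≤ n * p ^ expo p n m := by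
  by_contra! h
  have : Finset.range (expo p n m + 1) ⊆ (Finset.range m).filter fun j => n * p ^ j < m := by
    intro j hj
    rw [Finset.mem_range] at hj
    have h1 : n * p ^ j ≤ n * p ^ expo p n m :=
      Nat.mul_le_mul_left _ (Nat.pow_le_pow_right (by omega) (by omega))
    have h2 : j < p ^ j := Nat.lt_pow_self hp
    have h3 : p ^ j ≤ n * p ^ j := Nat.le_mul_of_pos_left _ hn
    simp only [Finset.mem_filter, Finset.mem_range]
    omega
  have := Finset.card_le_card this
  rw [Finset.card_range] at this
  exact absurd this (by simp [expo])

theorem expo_eq_zero {p n m : ℕ} (hp : 0 < p) (h : m ≤ n) : expo p n m = 0 := by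
  rw [expo, Finset.card_eq_zero, Finset.filter_eq_empty_iff]
  intro j _
  have := Nat.le_mul_of_pos_right n (Nat.pow_pos (n := j) hp)
  omega

/-- An integer in `(0, m)` is `n p^j` with `n` prime to `p` in only one way. -/
theorem sum_expo_le {p : ℕ} (hp : p.Prime) (m : ℕ) (S : Finset {n : ℕ // 0 < n ∧ ¬ p ∣ n}) :
    ∑ n ∈ S, expo p n m ≤ m - 1 := by
  have h : (S.sigma fun n => (Finset.range m).filter fun j => (n : ℕ) * p ^ j < m).card ≤
      (Finset.Ioo 0 m).card := by
    refine Finset.card_le_card_of_injOn (fun x => (x.1 : ℕ) * p ^ x.2) ?_ ?_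
    · rintro ⟨⟨n, hn⟩, j⟩ hx
      simp only [Finset.coe_sigma, Set.mem_sigma_iff, Finset.mem_coe, Finset.mem_filter] at hx
      simp only [Finset.coe_Ioo, Set.mem_Ioo]
      exact ⟨Nat.mul_pos hn.1 (Nat.pow_pos hp.pos), hx.2.2⟩
    · rintro ⟨⟨n, hn⟩, j⟩ _ ⟨⟨n', hn'⟩, j'⟩ _ hxy
      dsimp only at hxy
      have hv : ∀ n j : ℕ, ¬ p ∣ n → (n * p ^ j).factorization p = j := by
        intro n j hn
        have hn0 : n ≠ 0 := by
          rintro rfl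
          exact hn (dvd_zero p)
        rw [Nat.factorization_mul hn0 (pow_ne_zero _ hp.ne_zero)]
        simp [Nat.factorization_eq_zero_of_not_dvd hn, hp.factorization_self]
      have hj : j = j' := by rw [← hv n j hn.2, hxy, hv n' j' hn'.2]
      subst hj
      have : n = n' := Nat.eq_of_mul_eq_mul_right (Nat.pow_pos hp.pos) hxy
      subst this
      rfl
  rw [Finset.card_sigma, Nat.card_Ioo] at h
  exact h

theorem card_Iic_finsupp {σ : Type*} (d : σ →₀ ℕ) : Nat.card (Set.Iic d) = ∏ᶠ i, (d i + 1) := by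
  classical
  rw [finprod_eq_prod_of_mulSupport_subset (s := d.support) _ (by
    intro i hi
    simpa using hi)]
  rw [show Nat.card (Set.Iic d) = (Finset.Iic d).card by
    rw [← Finset.coe_Iic]
    simp, Finsupp.card_Iic]
  simp

-- The variables correspond to the one-units `1 + a_i t^n`, renumbered by `ℕ`. At level `m` the box
-- has side `p ^ expo p n m` in the direction `(n, i)`, so its size is `p` to the power `f ∑ expo p
-- n m ≤ f (m - 1)`.
open MvPowerSeries.WithPiTopology in
theorem exists_oneUnit_algEquiv_mvPowerSeries [TopologicalSpace R] (hadic : IsAdic I)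
    [IsAdicComplete I R] [I.IsMaximal] [∀ m, Finite (R ⧸ I ^ m)] [Finite (R ⧸ I)] {t : R}
    (hI : I = Ideal.span {t}) (hcard : ∀ n, Nat.card (R ⧸ I ^ n) = Nat.card (R ⧸ I) ^ n)
    {p : ℕ} (hp : p.Prime) (hpR : (p : R) = 0) :
    ∃ f : Alg I (oneUnitFiltration I) ≃ₐ[R] MvPowerSeries ℕ R,
      Continuous f ∧ Continuous f.symm := by
  have ht : t ∈ I := hI ▸ Ideal.mem_span_singleton_self t
  have hpk : (p : R ⧸ I) = 0 := by
    rw [← map_natCast (Ideal.Quotient.mk I), hpR, map_zero]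
  have : Fact p.Prime := ⟨hp⟩
  have : CharP (R ⧸ I) p := (CharP.charP_iff_prime_eq_zero hp).2 hpk
  let _ : Field (R ⧸ I) := Ideal.Quotient.field I
  let _ : Algebra (ZMod p) (R ⧸ I) := ZMod.algebra _ p
  let b := Module.finBasis (ZMod p) (R ⧸ I)
  let f := Module.finrank (ZMod p) (R ⧸ I)
  have hf : 0 < f := Module.finrank_pos
  have hQ : Nat.card (R ⧸ I) = p ^ f := by
    rw [Module.natCard_eq_pow_finrank (K := ZMod p), Nat.card_zmod]
  choose a ha using fun i => Ideal.Quotient.mk_surjective (b i)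
  have hspan : ∀ c : R, ∃ ε : Fin f → ℕ, c - ∑ᶠ i, ε i • a i ∈ I := by
    intro c
    refine ⟨fun i => (b.repr (Ideal.Quotient.mk I c) i).val, ?_⟩
    rw [← Ideal.Quotient.eq, finsum_eq_sum_of_fintype, map_sum]
    conv_lhs => rw [← b.sum_repr (Ideal.Quotient.mk I c)]
    refine Finset.sum_congr rfl fun i _ => ?_
    rw [map_nsmul, ha, ← Nat.cast_smul_eq_nsmul (ZMod p), ZMod.natCast_zmod_val]
  let σ := {n : ℕ // 0 < n ∧ ¬ p ∣ n} × Fin f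
  have : Nonempty (Fin f) := ⟨⟨0, hf⟩⟩
  have : Infinite {n : ℕ // 0 < n ∧ ¬ p ∣ n} :=
    Infinite.of_injective (fun n : ℕ => (⟨p * n + 1, Nat.succ_pos _, fun h =>
      hp.one_lt.ne' (Nat.dvd_one.1 ((Nat.dvd_add_right (dvd_mul_right p n)).1 h))⟩ :
        {n : ℕ // 0 < n ∧ ¬ p ∣ n}))
      fun x y hxy => by
        have := Subtype.ext_iff.1 hxy
        exact Nat.eq_of_mul_eq_mul_left hp.pos (by simpa using this)
  obtain ⟨ε⟩ : Nonempty (ℕ ≃ σ) := nonempty_equiv_of_countable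
  have hmem : ∀ s : σ, a s.2 * t ^ (s.1 : ℕ) ∈ I := fun s =>
    Ideal.mul_mem_left _ _ (Ideal.pow_mem_of_mem _ ht _ s.1.2.1)
  choose u hu using fun s : σ => exists_oneUnit (hmem s)
  have hfin : ∀ m, (Set.Finite {n : {n : ℕ // 0 < n ∧ ¬ p ∣ n} | (n : ℕ) < m}) := fun m =>
    (Set.finite_lt_nat m).preimage Subtype.val_injective.injOn
  have hsupp : ∀ m, (Function.support fun i : ℕ => p ^ expo p (ε i).1 m - 1).Finite := by
    intro m
    have : (Set.Finite {s : σ | (s.1 : ℕ) < m}) :=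
      ((hfin m).prod Set.finite_univ).subset fun s hs => ⟨hs, Set.mem_univ _⟩
    refine (this.preimage ε.injective.injOn).subset fun i hi => ?_
    by_contra h
    rw [Set.mem_preimage, Set.mem_ofPred_eq, not_lt] at h
    simp [expo_eq_zero hp.pos h] at hi
  -- Only the finitely many pairs with `n < m` contribute; for the others the generator is already
  -- trivial at level `m` and the side of the box is `1`.
  let d : ℕ → ℕ →₀ ℕ := fun m => Finsupp.ofSupportFinite _ (hsupp m)
  have hd : ∀ m i, d m i = p ^ expo p (ε i).1 m - 1 := fun m i => rfl
  have hd1 : ∀ m i, d m i + 1 = p ^ expo p (ε i).1 m := fun m i => by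
    rw [hd]
    exact Nat.sub_add_cancel (Nat.one_le_pow _ _ hp.pos)
  refine exists_algEquiv_mvPowerSeries I (oneUnitFiltration I) hadic hp hpR (u ∘ ε) d ?_ ?_ ?_ ?_ ?_
  · intro m m' hmm i
    rw [hd, hd]
    exact Nat.sub_le_sub_right (Nat.pow_le_pow_right hp.pos (expo_mono p _ hmm)) 1
  · intro i c
    refine ⟨(ε i).1 * p ^ c + 1, ?_⟩
    rw [hd]
    have h1 := Nat.pow_le_pow_right hp.pos (le_expo hp.one_lt (ε i).1.2.1 c)
    have h2 : c < p ^ c := Nat.lt_pow_self hp.one_lt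
    omega
  · intro m i
    refine ⟨_, hd1 m i, ?_⟩
    rw [mem_sub_oneUnitFiltration, Function.comp_apply, Subgroup.coe_pow,
      Units.val_pow_eq_pow_val, hu, add_pow_prime_pow hp hpR, one_pow, add_sub_cancel_left, mul_pow,
      ← pow_mul]
    exact Ideal.mul_mem_left _ _ (Ideal.pow_le_pow_right
      (le_mul_pow_expo hp.one_lt (ε i).1.2.1 m) (Ideal.pow_mem_pow ht _))
  · rw [ε.surjective.range_comp]
    refine closure_sup_sub_eq_top fun m hm v hv => exists_mem_closure_sub_mem hI hp hpR ?_ hm hv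
    intro n hn hpn
    refine exists_mem_closure_sub_mem_of_not_dvd hI hspan hn fun i => ?_
    exact ⟨u (⟨n, hn, hpn⟩, i), Subgroup.subset_closure ⟨_, rfl⟩, hu _⟩
  · intro m
    classical
    rw [card_Iic_finsupp]
    simp only [hd1]
    rw [finprod_comp_equiv ε (f := fun s : σ => p ^ expo p s.1 m)]
    have hprod : ∏ᶠ s : σ, p ^ expo p s.1 m =
        ∏ s ∈ (hfin m).toFinset ×ˢ (Finset.univ : Finset (Fin f)), p ^ expo p s.1 m := by
      refine finprod_eq_prod_of_mulSupport_subset _ fun s hs => ?_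
      rw [Finset.mem_coe, Finset.mem_product, Set.Finite.mem_toFinset]
      refine ⟨?_, Finset.mem_univ _⟩
      by_contra h
      rw [Set.mem_ofPred_eq, not_lt] at h
      simp [expo_eq_zero hp.pos h] at hs
    rw [hprod, Finset.prod_product]
    simp only [Finset.prod_const, Finset.card_univ, Fintype.card_fin]
    rw [Finset.prod_pow, Finset.prod_pow_eq_pow_sum, ← pow_mul]
    have hle := sum_expo_le hp m (hfin m).toFinset
    rcases Nat.eq_zero_or_pos m with rfl | hm
    · rw [Nat.le_zero.1 hle, zero_mul, pow_zero]
      exact Nat.card_pos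
    · have h := card_quot_le_mul_card_oneUnits (I := I) m
      have hQpos : 0 < Nat.card (R ⧸ I) := Nat.card_pos
      have hm1 : Nat.card (R ⧸ I) ^ m = Nat.card (R ⧸ I) * Nat.card (R ⧸ I) ^ (m - 1) := by
        rw [← pow_succ', Nat.sub_add_cancel hm]
      rw [hcard, hm1] at h
      refine le_trans ?_ (Nat.le_of_mul_le_mul_left h hQpos)
      rw [hQ, ← pow_mul, mul_comm f]
      exact Nat.pow_le_pow_right hp.pos (Nat.mul_le_mul_right f hle)

end OneUnits

/-! ### Roots of unity and characters of the residue field -/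

section Teichmuller

variable {R : Type*} [CommRing R] (I : Ideal R)

/-- Reduction of units `Rˣ → (R/I)ˣ`. -/
abbrev red : Rˣ →* (R ⧸ I)ˣ := Units.map (Ideal.Quotient.mk I : R →* R ⧸ I)

variable {I}

theorem red_eq_one_iff {u : Rˣ} : red I u = 1 ↔ u ∈ oneAdd I 1 := by
  rw [mem_oneAdd, pow_one, ← Ideal.Quotient.eq, map_one, Units.ext_iff]
  rfl

theorem exists_card_residue_eq_pow [I.IsMaximal] [Finite (R ⧸ I)] {p : ℕ} (hp : p.Prime)
    (hpR : (p : R) = 0) : ∃ f, 0 < f ∧ Nat.card (R ⧸ I) = p ^ f := by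
  have hpk : (p : R ⧸ I) = 0 := by
    rw [← map_natCast (Ideal.Quotient.mk I), hpR, map_zero]
  have : Fact p.Prime := ⟨hp⟩
  have : CharP (R ⧸ I) p := (CharP.charP_iff_prime_eq_zero hp).2 hpk
  let _ : Field (R ⧸ I) := Ideal.Quotient.field I
  let _ : Algebra (ZMod p) (R ⧸ I) := ZMod.algebra _ p
  refine ⟨Module.finrank (ZMod p) (R ⧸ I), Module.finrank_pos, ?_⟩
  rw [Module.natCard_eq_pow_finrank (K := ZMod p), Nat.card_zmod]

theorem card_residue_units_add_one [I.IsMaximal] [Finite (R ⧸ I)] :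
    Nat.card (R ⧸ I)ˣ + 1 = Nat.card (R ⧸ I) := by
  let _ : Field (R ⧸ I) := Ideal.Quotient.field I
  rw [Nat.card_units, Nat.sub_add_cancel Nat.card_pos]

/-- The order `Q` of the residue field is a positive power of `p`, hence zero in `R`. So the order
of `κˣ` is a unit, as Hensel's lemma and orthogonality require. -/
theorem natCast_card_residue_units [I.IsMaximal] [Finite (R ⧸ I)] {p : ℕ} (hp : p.Prime)
    (hpR : (p : R) = 0) : (Nat.card (R ⧸ I)ˣ : R) = -1 := by
  obtain ⟨f, hf, hQ⟩ := exists_card_residue_eq_pow (I := I) hp hpR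
  rw [← card_residue_units_add_one] at hQ
  have := congrArg (Nat.cast : ℕ → R) hQ
  push_cast at this
  rw [hpR, zero_pow hf.ne'] at this
  exact eq_neg_of_add_eq_zero_left this

/-- From `ζ^Q = ζ`, the element `x = ζ - 1` of `I` satisfies `x^Q = x`, so it lies in every power of
`I`. -/
theorem eq_one_of_mem_oneAdd_of_pow_eq_one [I.IsMaximal] [IsAdicComplete I R] [Finite (R ⧸ I)]
    {p : ℕ} (hp : p.Prime) (hpR : (p : R) = 0) {ζ : Rˣ} (hζ : ζ ^ Nat.card (R ⧸ I)ˣ = 1)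
    (h1 : ζ ∈ oneAdd I 1) : ζ = 1 := by
  obtain ⟨f, hf, hQ⟩ := exists_card_residue_eq_pow (I := I) hp hpR
  have hpow : (ζ : R) ^ p ^ f = ζ := by
    rw [← hQ, ← card_residue_units_add_one, pow_succ, ← Units.val_pow_eq_pow_val, hζ, Units.val_one,
      one_mul]
  have hx : ((ζ : R) - 1) ^ p ^ f = (ζ : R) - 1 := by
    rw [sub_one_pow_prime_pow hp hpR, hpow]
  have hmem : ∀ m, (ζ : R) - 1 ∈ I ^ (m + 1) := by
    intro m
    induction m with
    | zero => exact mem_oneAdd.1 h1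
    | succ m ih =>
      rw [← hx]
      have := Ideal.pow_mem_pow ih (p ^ f)
      rw [← pow_mul] at this
      refine Ideal.pow_le_pow_right ?_ this
      have := Nat.one_lt_pow hf.ne' hp.one_lt
      nlinarith
  have h0 : (ζ : R) - 1 = 0 := IsHausdorff.haus' (I := I) _ fun m => by
    rw [SModEq.zero, smul_eq_mul, Ideal.mul_top]
    exact Ideal.pow_le_pow_right (Nat.le_succ m) (hmem m)
  exact Units.ext (sub_eq_zero.1 h0)

theorem isUnit_of_notMem [I.IsMaximal] [IsAdicComplete I R] {x : R} (hx : x ∉ I) : IsUnit x := by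
  let _ : Field (R ⧸ I) := Ideal.Quotient.field I
  have := isLocalHom_of_le_jacobson_bot I (IsAdicComplete.le_jacobson_bot I)
  refine isUnit_of_map_unit (Ideal.Quotient.mk I) x (isUnit_iff_ne_zero.2 ?_)
  rwa [Ne, Ideal.Quotient.eq_zero_iff_mem]

theorem exists_pow_eq_one_red_eq [I.IsMaximal] [IsAdicComplete I R] [Finite (R ⧸ I)]
    {p : ℕ} (hp : p.Prime) (hpR : (p : R) = 0) (c : (R ⧸ I)ˣ) :
    ∃ ζ : Rˣ, ζ ^ Nat.card (R ⧸ I)ˣ = 1 ∧ red I ζ = c := by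
  have hn : Nat.card (R ⧸ I)ˣ ≠ 0 := Nat.card_pos.ne'
  obtain ⟨a₀, ha₀⟩ := Ideal.Quotient.mk_surjective (c : R ⧸ I)
  have ha : Ideal.Quotient.mk I a₀ ^ Nat.card (R ⧸ I)ˣ = 1 := by
    rw [ha₀, ← Units.val_pow_eq_pow_val, pow_card_eq_one', Units.val_one]
  -- The derivative of `X^(Q-1) - 1` is `-X^(Q-2)`, a unit at any nonzero residue.
  obtain ⟨a, haroot, haa⟩ := HenselianRing.is_henselian (I := I)
    (X ^ Nat.card (R ⧸ I)ˣ - 1 : R[X]) (monic_X_pow_sub_C 1 hn) a₀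
    (by
      rw [← Ideal.Quotient.eq_zero_iff_mem]
      simp [ha])
    (by
      have : IsUnit (Ideal.Quotient.mk I a₀) := ha₀ ▸ c.isUnit
      rw [derivative_sub, derivative_one, sub_zero, derivative_X_pow, eval_mul, eval_C, eval_pow,
        eval_X, natCast_card_residue_units hp hpR, map_mul, map_neg, map_one, map_pow, neg_one_mul]
      exact (this.pow _).neg)
  have hapow : a ^ Nat.card (R ⧸ I)ˣ = 1 := by
    simpa [IsRoot.def, sub_eq_zero] using haroot
  refine ⟨Units.ofPowEqOne a _ hapow hn, Units.ext (by simp), Units.ext ?_⟩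
  change Ideal.Quotient.mk I a = c
  rw [← ha₀]
  exact Ideal.Quotient.eq.2 haa

theorem exists_teichmuller [I.IsMaximal] [IsAdicComplete I R] [Finite (R ⧸ I)]
    {p : ℕ} (hp : p.Prime) (hpR : (p : R) = 0) :
    ∃ τ : (R ⧸ I)ˣ →* Rˣ, (∀ c, red I (τ c) = c) ∧
      ∀ ζ : Rˣ, ζ ^ Nat.card (R ⧸ I)ˣ = 1 → τ (red I ζ) = ζ := by
  choose τ hτ1 hτ2 using exists_pow_eq_one_red_eq (I := I) hp hpR
  have huniq : ∀ ζ ζ' : Rˣ, ζ ^ Nat.card (R ⧸ I)ˣ = 1 → ζ' ^ Nat.card (R ⧸ I)ˣ = 1 →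
      red I ζ = red I ζ' → ζ = ζ' := by
    intro ζ ζ' h h' hr
    have : ζ / ζ' = 1 := eq_one_of_mem_oneAdd_of_pow_eq_one (I := I) hp hpR
      (by rw [div_pow, h, h', div_one]) (by rw [← red_eq_one_iff, _root_.map_div, hr, div_self'])
    exact div_eq_one.1 this
  refine ⟨MonoidHom.mk' τ fun a b => ?_, hτ2, fun ζ hζ => ?_⟩
  · refine huniq _ _ (hτ1 _) ?_ ?_
    · rw [mul_pow, hτ1, hτ1, one_mul]
    · rw [map_mul, hτ2, hτ2, hτ2]
  · exact huniq _ _ (hτ1 _) hζ (hτ2 _)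

theorem char_injective [I.IsMaximal] [IsAdicComplete I R] [Finite (R ⧸ I)]
    {p : ℕ} (hp : p.Prime) (hpR : (p : R) = 0) :
    Function.Injective fun (χ : (R ⧸ I)ˣ →* Rˣ) (c : (R ⧸ I)ˣ) => red I (χ c) := by
  intro χ χ' h
  ext1 c
  have hc := congrFun h c
  have : χ c / χ' c = 1 := eq_one_of_mem_oneAdd_of_pow_eq_one (I := I) hp hpR
    (by rw [div_pow, ← map_pow, ← map_pow, pow_card_eq_one', map_one, map_one, div_one])
    (by
      dsimp only at hc
      rw [← red_eq_one_iff, _root_.map_div, hc, div_self'])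
  exact div_eq_one.1 this

theorem finite_chars [I.IsMaximal] [IsAdicComplete I R] [Finite (R ⧸ I)]
    {p : ℕ} (hp : p.Prime) (hpR : (p : R) = 0) : Finite ((R ⧸ I)ˣ →* Rˣ) :=
  Finite.of_injective _ (char_injective (I := I) hp hpR)

/-- The usual translation argument needs `χ c₀ / χ' c₀ - 1` to be a unit. It is one, because a root
of unity of order dividing `#κˣ` that is congruent to `1` equals `1`. -/
theorem sum_char_div_eq_zero [I.IsMaximal] [IsAdicComplete I R] [Finite (R ⧸ I)]
    {p : ℕ} (hp : p.Prime) (hpR : (p : R) = 0) [Fintype (R ⧸ I)ˣ] {χ χ' : (R ⧸ I)ˣ →* Rˣ}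
    (h : χ ≠ χ') : ∑ c, ((χ c / χ' c : Rˣ) : R) = 0 := by
  obtain ⟨c₀, hc₀⟩ : ∃ c₀, χ c₀ / χ' c₀ ≠ 1 := by
    by_contra! hall
    exact h (MonoidHom.ext fun c => div_eq_one.1 (hall c))
  have hunit : IsUnit (((χ c₀ / χ' c₀ : Rˣ) : R) - 1) := by
    refine isUnit_of_notMem (I := I) fun hmem => hc₀ ?_
    refine eq_one_of_mem_oneAdd_of_pow_eq_one (I := I) hp hpR ?_
      (mem_oneAdd.2 (by rwa [pow_one]))
    rw [div_pow, ← map_pow, ← map_pow, pow_card_eq_one', map_one, map_one, div_one]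
  have hinv : ((χ c₀ / χ' c₀ : Rˣ) : R) * ∑ c, ((χ c / χ' c : Rˣ) : R) =
      ∑ c, ((χ c / χ' c : Rˣ) : R) := by
    rw [Finset.mul_sum]
    refine Fintype.sum_equiv (Equiv.mulLeft c₀) _ _ fun c => ?_
    rw [Equiv.coe_mulLeft, map_mul, map_mul, ← Units.val_mul, div_mul_div_comm]
  refine hunit.mul_right_eq_zero.1 ?_
  rw [sub_mul, hinv, one_mul, sub_self]

/-- `κˣ` is cyclic, and the powers `τ^k` with `k < #κˣ` differ at a generator. -/
theorem card_residue_units_le_card_chars [I.IsMaximal] [IsAdicComplete I R] [Finite (R ⧸ I)]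
    {p : ℕ} (hp : p.Prime) (hpR : (p : R) = 0) {τ : (R ⧸ I)ˣ →* Rˣ}
    (hτ : ∀ c, red I (τ c) = c) : Nat.card (R ⧸ I)ˣ ≤ Nat.card ((R ⧸ I)ˣ →* Rˣ) := by
  have := finite_chars (I := I) hp hpR
  let _ : Field (R ⧸ I) := Ideal.Quotient.field I
  obtain ⟨g, hg⟩ := IsCyclic.exists_generator (α := (R ⧸ I)ˣ)
  have hord := orderOf_eq_card_of_forall_mem_zpowers hg
  have hinj : Function.Injective fun k : Fin (Nat.card (R ⧸ I)ˣ) =>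
      τ.comp (powMonoidHom (k : ℕ)) := by
    intro k l hkl
    have h1 : τ (g ^ (k : ℕ)) = τ (g ^ (l : ℕ)) := DFunLike.congr_fun hkl g
    have h2 : g ^ (k : ℕ) = g ^ (l : ℕ) := by rw [← hτ (g ^ (k : ℕ)), h1, hτ]
    exact Fin.ext (pow_injOn_Iio_orderOf (by rw [hord]; exact k.2) (by rw [hord]; exact l.2) h2)
  simpa using Nat.card_le_card_of_injective _ hinj

end Teichmuller

/-! ### Decomposition of `Λ` by characters -/

section Decomposition

variable {R : Type*} [CommRing R] {I : Ideal R}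

theorem level_algHom_ext {G : Type*} [CommGroup G] {N : ℕ →o (Subgroup G)ᵒᵈ} {m : ℕ} {B : Type*}
    [CommRing B] [Algebra R B] {φ ψ : Level I N m →ₐ[R] B}
    (h : ∀ g : G, φ (MonoidAlgebra.single (QuotientGroup.mk g : G ⧸ sub N m) 1) =
      ψ (MonoidAlgebra.single (QuotientGroup.mk g : G ⧸ sub N m) 1)) : φ = ψ := by
  refine MonoidAlgebra.algHom_ext (fun g => ?_) (Ideal.Quotient.algHom_ext _ (by ext))
  obtain ⟨g, rfl⟩ := QuotientGroup.mk_surjective g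
  exact h g

theorem subsingleton_level_zero {G : Type*} [CommGroup G] (N : ℕ →o (Subgroup G)ᵒᵈ) :
    Subsingleton (Level I N 0) := by
  refine subsingleton_of_zero_eq_one ?_
  rw [← map_one (algebraMap R (Level I N 0)), algebraMap_level_eq_zero I N (by simp)]

variable (τ : (R ⧸ I)ˣ →* Rˣ) (hτ : ∀ c, red I (τ c) = c)

/-- The projection `u ↦ u / τ(u mod I)` of the units onto the one-units. -/
def onePart : Rˣ →* oneAdd I 1 :=
  (MonoidHom.id Rˣ / τ.comp (red I)).codRestrict (oneAdd I 1) fun u => by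
    rw [← red_eq_one_iff, MonoidHom.div_apply, _root_.map_div, MonoidHom.comp_apply, hτ]
    exact div_self' _

theorem coe_onePart (u : Rˣ) : (onePart τ hτ u : Rˣ) = u / τ (red I u) := rfl

theorem onePart_mem {m : ℕ} {u : Rˣ} (hu : u ∈ oneAdd I m) :
    onePart τ hτ u ∈ sub (oneUnitFiltration I) m := by
  rcases Nat.eq_zero_or_pos m with rfl | hm
  · rw [mem_sub_oneUnitFiltration, pow_zero, Ideal.one_eq_top]
    exact Submodule.mem_top
  · change (onePart τ hτ u : Rˣ) ∈ oneAdd I m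
    rwa [coe_onePart, red_eq_one_iff.2 (oneAdd_anti I hm hu), map_one, div_one]

theorem onePart_coe (v : oneAdd I 1) : onePart τ hτ v = v :=
  Subtype.ext (by rw [coe_onePart, red_eq_one_iff.2 v.2, map_one, div_one])

theorem onePart_teichmuller (c : (R ⧸ I)ˣ) : onePart τ hτ (τ c) = 1 :=
  Subtype.ext (by rw [coe_onePart, hτ, div_self', Subgroup.coe_one])

/-- The homomorphism `u ↦ χ(u mod I) [u / τ(u mod I)]`. -/
def charHom (χ : (R ⧸ I)ˣ →* Rˣ) (m : ℕ) :
    Rˣ ⧸ sub (unitFiltration I) m →* Level I (oneUnitFiltration I) m :=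
  QuotientGroup.lift _
    ((((algebraMap R (Level I (oneUnitFiltration I) m) : R →* _).comp (Units.coeHom R)).comp
        (χ.comp (red I))) *
      ((MonoidAlgebra.of (R ⧸ I ^ m) (oneAdd I 1 ⧸ sub (oneUnitFiltration I) m)).comp
        ((QuotientGroup.mk' _).comp (onePart τ hτ))))
    (by
      intro u hu
      -- At level `0` every unit must map to `1`, which holds only because the target is the zero
      -- ring.
      rcases Nat.eq_zero_or_pos m with rfl | hm
      · have := subsingleton_level_zero (I := I) (oneUnitFiltration I)
        exact Subsingleton.elim _ _
      · have h1 : red I u = 1 := red_eq_one_iff.2 (oneAdd_anti I hm hu)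
        have h2 : (QuotientGroup.mk' (sub (oneUnitFiltration I) m)) (onePart τ hτ u) = 1 :=
          (QuotientGroup.eq_one_iff _).2 (onePart_mem τ hτ hu)
        change algebraMap R _ ((χ (red I u) : Rˣ) : R) * MonoidAlgebra.of (R ⧸ I ^ m) _
          (QuotientGroup.mk' (sub (oneUnitFiltration I) m) (onePart τ hτ u)) = 1
        rw [h1, h2, map_one, map_one, Units.val_one, map_one, mul_one])

/-- The `χ`-component of the decomposition, at level `m`. -/
def levelChar (χ : (R ⧸ I)ˣ →* Rˣ) (m : ℕ) :
    Level I (unitFiltration I) m →ₐ[R] Level I (oneUnitFiltration I) m :=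
  (MonoidAlgebra.lift (R ⧸ I ^ m) _ _ (charHom τ hτ χ m)).restrictScalars R

theorem levelChar_single (χ : (R ⧸ I)ˣ →* Rˣ) (m : ℕ) (u : Rˣ) :
    levelChar τ hτ χ m
      (MonoidAlgebra.single (QuotientGroup.mk u : Rˣ ⧸ sub (unitFiltration I) m) 1) =
    (χ (red I u) : R) • MonoidAlgebra.single
      (QuotientGroup.mk (onePart τ hτ u) : oneAdd I 1 ⧸ sub (oneUnitFiltration I) m) 1 := by
  rw [levelChar, AlgHom.restrictScalars_apply, MonoidAlgebra.lift_single, one_smul, Algebra.smul_def]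
  rfl

theorem transition_single_one {G : Type*} [CommGroup G] (N : ℕ →o (Subgroup G)ᵒᵈ) (m : ℕ) (g : G) :
    transition I N m (MonoidAlgebra.single (QuotientGroup.mk g : G ⧸ sub N (m + 1)) 1) =
    MonoidAlgebra.single (QuotientGroup.mk g : G ⧸ sub N m) 1 := by
  simpa only [map_one] using transition_single I N m g 1

theorem transition_levelChar (χ : (R ⧸ I)ˣ →* Rˣ) (m : ℕ) (x : Level I (unitFiltration I) (m + 1)) :
    transition I _ m (levelChar τ hτ χ (m + 1) x) = levelChar τ hτ χ m (transition I _ m x) := by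
  have : (transition I _ m).comp (levelChar τ hτ χ (m + 1)) =
      (levelChar τ hτ χ m).comp (transition I _ m) := by
    refine level_algHom_ext fun u => ?_
    rw [AlgHom.comp_apply, AlgHom.comp_apply, levelChar_single, map_smul, transition_single_one,
      transition_single_one, levelChar_single]
  exact DFunLike.congr_fun this x

/-- The inclusion of the `m`-th level for the one-units into the one for the units. -/
def levelIncl (m : ℕ) : Level I (oneUnitFiltration I) m →ₐ[R] Level I (unitFiltration I) m :=
  MonoidAlgebra.mapDomainAlgHom R (R ⧸ I ^ m)
    (QuotientGroup.map (sub (oneUnitFiltration I) m) (sub (unitFiltration I) m)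
      (oneAdd I 1).subtype fun _ hu => hu)

theorem levelChar_levelIncl (χ : (R ⧸ I)ˣ →* Rˣ) (m : ℕ) (x : Level I (oneUnitFiltration I) m) :
    levelChar τ hτ χ m (levelIncl m x) = x := by
  have : (levelChar τ hτ χ m).comp (levelIncl m) = AlgHom.id R _ := by
    refine level_algHom_ext fun v => ?_
    have h : levelIncl m (MonoidAlgebra.single
        (QuotientGroup.mk v : oneAdd I 1 ⧸ sub (oneUnitFiltration I) m) (1 : R ⧸ I ^ m)) =
        MonoidAlgebra.single (QuotientGroup.mk (v : Rˣ) : Rˣ ⧸ sub (unitFiltration I) m) 1 :=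
      MonoidAlgebra.mapDomain_single
    rw [AlgHom.comp_apply, h, levelChar_single, red_eq_one_iff.2 v.2, map_one, Units.val_one,
      one_smul, onePart_coe, AlgHom.id_apply]
  exact DFunLike.congr_fun this x

theorem card_quot_unitFiltration_le [Finite (R ⧸ I)] [∀ m, Finite (R ⧸ I ^ m)]
    {τ : (R ⧸ I)ˣ →* Rˣ} (hτ : ∀ c, red I (τ c) = c) (m : ℕ) :
    Nat.card (Rˣ ⧸ sub (unitFiltration I) m) ≤
    Nat.card (R ⧸ I)ˣ * Nat.card (oneAdd I 1 ⧸ sub (oneUnitFiltration I) m) := by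
  rw [← Nat.card_prod]
  refine Nat.card_le_card_of_injective (fun y => (red I y.out,
    (QuotientGroup.mk (onePart τ hτ y.out) : oneAdd I 1 ⧸ sub (oneUnitFiltration I) m)))
    fun y z hyz => ?_
  obtain ⟨h1, h2⟩ := Prod.ext_iff.1 hyz
  dsimp only at h1 h2
  rw [QuotientGroup.eq] at h2
  have h3 : (onePart τ hτ y.out : Rˣ)⁻¹ * (onePart τ hτ z.out : Rˣ) ∈ oneAdd I m := h2
  rw [coe_onePart, coe_onePart, h1, inv_div, div_mul_div_cancel', ← inv_mul_eq_div] at h3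
  rw [← QuotientGroup.out_eq' y, ← QuotientGroup.out_eq' z, QuotientGroup.eq]
  exact h3

variable [I.IsMaximal] [IsAdicComplete I R] [Finite (R ⧸ I)]

/-- Up to sign, `ε χ'` is the idempotent of `χ'`: by orthogonality its components vanish except at
`χ'`, where it is `#κˣ = -1`. Elements of the level for `1 + I` are placed in one component by
multiplying their image under `levelIncl` by it. -/
theorem levelChar_surjective {p : ℕ} (hp : p.Prime) (hpR : (p : R) = 0) (m : ℕ) :
    Function.Surjective fun (x : Level I (unitFiltration I) m) χ => levelChar τ hτ χ m x := by
  classical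
  have := finite_chars (I := I) hp hpR
  have := Fintype.ofFinite ((R ⧸ I)ˣ →* Rˣ)
  have := Fintype.ofFinite (R ⧸ I)ˣ
  let ε : ((R ⧸ I)ˣ →* Rˣ) → Level I (unitFiltration I) m := fun χ' =>
    ∑ c, (((χ' c)⁻¹ : Rˣ) : R) •
      MonoidAlgebra.single (QuotientGroup.mk (τ c) : Rˣ ⧸ sub (unitFiltration I) m) 1
  have hε : ∀ χ χ', levelChar τ hτ χ m (ε χ') = if χ' = χ then -1 else 0 := by
    intro χ χ'
    have h1 : levelChar τ hτ χ m (ε χ') =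
        (∑ c, ((χ c / χ' c : Rˣ) : R)) • (1 : Level I (oneUnitFiltration I) m) := by
      simp only [ε, map_sum, map_smul, levelChar_single, hτ, onePart_teichmuller, smul_smul,
        Finset.sum_smul]
      refine Finset.sum_congr rfl fun c _ => ?_
      rw [← Units.val_mul, ← div_eq_inv_mul, QuotientGroup.mk_one, ← MonoidAlgebra.one_def]
    rw [h1]
    split_ifs with h
    · subst h
      simp only [div_self', Units.val_one, Finset.sum_const, Finset.card_univ, nsmul_eq_mul, mul_one]
      rw [← Nat.card_eq_fintype_card, natCast_card_residue_units hp hpR, neg_one_smul]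
    · rw [sum_char_div_eq_zero hp hpR (Ne.symm h), zero_smul]
  intro y
  refine ⟨-∑ χ', levelIncl m (y χ') * ε χ', funext fun χ => ?_⟩
  simp only [map_neg, map_sum, map_mul, levelChar_levelIncl, hε, mul_ite, mul_neg, mul_one,
    mul_zero, Finset.sum_ite_eq', Finset.mem_univ, if_true, neg_neg]

variable [∀ m, Finite (R ⧸ I ^ m)]

theorem levelChar_bijective {p : ℕ} (hp : p.Prime) (hpR : (p : R) = 0) (m : ℕ) :
    Function.Bijective fun (x : Level I (unitFiltration I) m) χ => levelChar τ hτ χ m x := by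
  have := finite_chars (I := I) hp hpR
  refine (levelChar_surjective τ hτ hp hpR m).bijective_of_nat_card_le ?_
  rw [Nat.card_fun, nat_card_level, nat_card_level, ← pow_mul, mul_comm]
  refine Nat.pow_le_pow_right Nat.card_pos ((card_quot_unitFiltration_le hτ m).trans ?_)
  exact Nat.mul_le_mul_right _ (card_residue_units_le_card_chars hp hpR hτ)

theorem exists_algEquiv_pi {p : ℕ} (hp : p.Prime) (hpR : (p : R) = 0) :
    ∃ e : Alg I (unitFiltration I) ≃ₐ[R] (((R ⧸ I)ˣ →* Rˣ) → Alg I (oneUnitFiltration I)),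
      Continuous e ∧ Continuous e.symm ∧
      ∀ (ζ : Rˣ) (v : oneAdd I 1) (χ : (R ⧸ I)ˣ →* Rˣ), ζ ^ Nat.card (R ⧸ I)ˣ = 1 →
        e (of I (unitFiltration I) (ζ * (v : Rˣ))) χ =
          (χ (red I ζ) : R) • of I (oneUnitFiltration I) v := by
  obtain ⟨τ, hτ, hτ'⟩ := exists_teichmuller (I := I) hp hpR
  let c : ∀ χ : (R ⧸ I)ˣ →* Rˣ, Alg I (unitFiltration I) →ₐ[R] Alg I (oneUnitFiltration I) :=
    fun χ => limLift I _ (fun m => (levelChar τ hτ χ m).comp (proj I _ m)) fun m x => by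
      rw [AlgHom.comp_apply, transition_levelChar, transition_proj, AlgHom.comp_apply]
  have hc : ∀ χ m x, proj I _ m (c χ x) = levelChar τ hτ χ m (proj I _ m x) := fun _ _ _ => rfl
  have hbij : Function.Bijective (AlgHom.pi c) := by
    constructor
    · intro x y hxy
      refine alg_ext fun m => (levelChar_bijective τ hτ hp hpR m).1 (funext fun χ => ?_)
      exact congrArg (proj I _ m) (congrFun hxy χ)
    · intro y
      choose x hx using fun m =>
        (levelChar_bijective τ hτ hp hpR m).2 fun χ => proj I _ m (y χ)
      refine ⟨⟨x, fun m => (levelChar_bijective τ hτ hp hpR m).1 ?_⟩, funext fun χ =>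
        alg_ext fun m => congrFun (hx m) χ⟩
      rw [hx m]
      funext χ
      have h := congrFun (hx (m + 1)) χ
      dsimp only at h ⊢
      rw [← transition_levelChar, h, transition_proj]
  let e := AlgEquiv.ofBijective (AlgHom.pi c) hbij
  have he : ∀ x χ, e x χ = c χ x := fun _ _ => rfl
  have hL := alg_isProfiniteRing I (unitFiltration I)
  have hL0 := alg_isProfiniteRing I (oneUnitFiltration I)
  have := hL.isTopologicalRing
  have := hL.compactSpace
  have := hL0.isTopologicalRing
  have := hL0.t2Space
  have hcont : Continuous e := by
    refine continuous_pi fun χ => ?_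
    refine continuous_of_continuousAt_zero (c χ) ?_
    rw [ContinuousAt, map_zero, (nhds_zero_hasBasis I _).tendsto_iff (nhds_zero_hasBasis I _)]
    intro m _
    refine ⟨m, trivial, fun x hx => ?_⟩
    rw [SetLike.mem_coe, RingHom.mem_ker] at hx ⊢
    rw [hc, hx, map_zero]
  refine ⟨e, hcont, ?_, fun ζ v χ hζ => ?_⟩
  -- A continuous bijection from a compact space to a Hausdorff space is a homeomorphism.
  · exact (Continuous.homeoOfEquivCompactToT2 (f := e.toEquiv) hcont).symm.continuous
  · refine alg_ext fun m => ?_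
    have h1 : red I (ζ * (v : Rˣ)) = red I ζ := by
      rw [map_mul, red_eq_one_iff.2 v.2, mul_one]
    have h2 : onePart τ hτ (ζ * (v : Rˣ)) = v := by
      refine Subtype.ext ?_
      rw [coe_onePart, h1, hτ' ζ hζ, mul_div_cancel_left]
    rw [he, hc, proj_of, levelChar_single, h1, h2, map_smul, proj_of]

end Decomposition

/-! ### Filtrations annihilated by an ideal in the Jacobson radical -/

section Filtration

variable {S : Type*} [CommRing S]

/-- The image of `M` lies in the Jacobson radical of the finite, hence Artinian, ring `S ⧸ J`, which
is nilpotent. -/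
theorem exists_pow_le_of_le_jacobson {M J : Ideal S} [Finite (S ⧸ J)]
    (hM : M ≤ Ideal.jacobson ⊥) : ∃ k, M ^ k ≤ J := by
  obtain ⟨k, hk⟩ := IsArtinianRing.isNilpotent_jacobson_bot (R := S ⧸ J)
  have hle : M.map (Ideal.Quotient.mk J) ≤ Ideal.jacobson ⊥ := by
    rw [Ideal.map_le_iff_le_comap]
    intro x hx
    rw [Ideal.mem_comap, Ideal.mem_jacobson_bot]
    intro y
    obtain ⟨y, rfl⟩ := Ideal.Quotient.mk_surjective y
    have := (Ideal.mem_jacobson_bot.1 (hM hx) y).map (Ideal.Quotient.mk J)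
    simpa using this
  refine ⟨k, ?_⟩
  have h := Ideal.pow_right_mono hle k
  rw [hk, ← Ideal.map_pow, Ideal.zero_eq_bot, le_bot_iff, Ideal.map_eq_bot_iff_le_ker,
    Ideal.mk_ker] at h
  exact h

/-- All maximal ideals contain `M`, so they come from ideals of the finite ring `S ⧸ M`. -/
theorem finite_maximalSpectrum_of_le_jacobson {M : Ideal S} [Finite (S ⧸ M)]
    (hM : M ≤ Ideal.jacobson ⊥) : Finite (MaximalSpectrum S) := by
  have : Finite (Ideal (S ⧸ M)) := Finite.of_injective _ SetLike.coe_injective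
  refine Finite.of_injective
    (fun P : MaximalSpectrum S => P.asIdeal.map (Ideal.Quotient.mk M)) fun P Q hPQ => ?_
  have h : ∀ P : MaximalSpectrum S,
      (P.asIdeal.map (Ideal.Quotient.mk M)).comap (Ideal.Quotient.mk M) = P.asIdeal := by
    intro P
    rw [Ideal.comap_map_of_surjective' _ Ideal.Quotient.mk_surjective, Ideal.mk_ker, sup_eq_left]
    exact hM.trans (sInf_le ⟨bot_le, P.isMaximal⟩)
  refine MaximalSpectrum.ext ?_
  rw [← h P, ← h Q]
  exact congrArg _ hPQ

theorem quotActsThrough_of_mul_le {B : Type*} [CommRing B] {π : S →+* B}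
    (hπ : Function.Surjective π) {J J' : Ideal S} (h : RingHom.ker π * J ≤ J') :
    QuotActsThrough π J J' := by
  let g : S →+* Module.End S (J ⧸ J'.submoduleOf J) := algebraMap S _
  have hg : RingHom.ker π ≤ RingHom.ker g := by
    intro x hx
    rw [RingHom.mem_ker]
    refine LinearMap.ext fun v => ?_
    obtain ⟨v, rfl⟩ := Submodule.Quotient.mk_surjective _ v
    change x • (Submodule.Quotient.mk v : J ⧸ J'.submoduleOf J) = 0
    rw [← Submodule.Quotient.mk_smul, Submodule.Quotient.mk_eq_zero]
    exact h (Ideal.mul_mem_mul hx v.2)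
  refine ⟨RingHom.liftOfSurjective π hπ ⟨g, hg⟩, fun x v => ?_⟩
  have : RingHom.liftOfSurjective π hπ ⟨g, hg⟩ (π x) = g x :=
    RingHom.liftOfRightInverse_comp_apply π _ _ ⟨g, hg⟩ x
  rw [this]
  rfl

/-- The topology of a ring defined by ideals of finite index is defined by a chain of ideals that
starts at a given open ideal in the Jacobson radical, which annihilates its subquotients. -/
theorem exists_filtration [TopologicalSpace S] {J : ℕ → Ideal S} (hJ : Antitone J)
    (hbasis : (𝓝 (0 : S)).HasBasis (fun _ : ℕ => True) fun m => (J m : Set S))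
    (hfin : ∀ m, Finite (S ⧸ J m)) {B : Type*} [CommRing B] {π : S →+* B}
    (hπ : Function.Surjective π) (hM : (RingHom.ker π : Set S) ∈ 𝓝 0)
    (hjac : RingHom.ker π ≤ Ideal.jacobson ⊥) :
    ∃ I : ℕ → Ideal S, Antitone I ∧
      (𝓝 (0 : S)).HasBasis (fun _ : ℕ => True) (fun r => (I r : Set S)) ∧
      (∀ r, Finite (S ⧸ I r)) ∧ I 0 = RingHom.ker π ∧
      ∀ r, QuotActsThrough π (I r) (I (r + 1)) := by
  set M := RingHom.ker π
  -- The subtraction is truncated. For `m ≥ r` the term is just `M`, so `I r` contains `M ⊓ J r` and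
  -- is open. For fixed `m` the power of `M` grows with `r`, until it falls into `J m`. Multiplying
  -- by `M` raises each power by one, which gives `M * I r ≤ I (r + 1)`.
  let I : ℕ → Ideal S := fun r => ⨅ m, (M ^ (1 + (r - m)) ⊔ M ⊓ J m)
  have hmem : ∀ r, (I r : Set S) ∈ 𝓝 0 := by
    intro r
    refine Filter.mem_of_superset (Filter.inter_mem hM (hbasis.mem_of_mem (i := r) trivial)) ?_
    have : M ⊓ J r ≤ I r := by
      refine le_iInf fun m => ?_
      rcases le_total m r with h | h
      · exact (inf_le_inf_left M (hJ h)).trans le_sup_right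
      · rw [Nat.sub_eq_zero_of_le h, add_zero, pow_one]
        exact inf_le_left.trans le_sup_left
    exact this
  refine ⟨I, ?_, ?_, ?_, ?_, ?_⟩
  · intro r s hrs
    exact iInf_mono fun m => sup_le_sup_right (Ideal.pow_le_pow_right (by omega)) _
  · refine ⟨fun U => ⟨fun hU => ?_, fun ⟨r, _, hr⟩ => Filter.mem_of_superset (hmem r) hr⟩⟩
    obtain ⟨m, -, hm⟩ := hbasis.mem_iff.1 hU
    have := hfin m
    obtain ⟨k, hk⟩ := exists_pow_le_of_le_jacobson (J := J m) hjac
    refine ⟨m + k, trivial, Set.Subset.trans (SetLike.coe_subset_coe.2 ?_) hm⟩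
    refine (iInf_le _ m).trans (sup_le ((Ideal.pow_le_pow_right ?_).trans hk) inf_le_right)
    omega
  · intro r
    obtain ⟨m, -, hm⟩ := hbasis.mem_iff.1 (hmem r)
    have := hfin m
    exact Finite.of_surjective _ (Ideal.Quotient.factor_surjective (SetLike.coe_subset_coe.1 hm))
  · simp only [I, Nat.zero_sub, add_zero, pow_one, sup_eq_left.2 (inf_le_left : M ⊓ _ ≤ M),
      iInf_const]
  · refine fun r => quotActsThrough_of_mul_le hπ ?_
    refine le_iInf fun m => (Ideal.mul_mono_right (iInf_le _ m)).trans ?_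
    rw [Ideal.mul_sup, ← pow_succ']
    exact sup_le_sup (Ideal.pow_le_pow_right (by omega)) Ideal.mul_le_right

end Filtration

/-! ### The reduction `Λ → ∏_χ κ(𝔭)` -/

section Main

variable {F : Type*} [Field F] {ϖ : F[X]}

theorem residueProd_surjective (e : Lam ϖ ≃ₐ[Ap ϖ] (Chars ϖ → Lam0 ϖ)) :
    Function.Surjective (residueProd ϖ e) := by
  intro y
  choose x hx using fun χ => residue_surjective (pp ϖ) (oneUnitFiltration (pp ϖ)) (y χ)
  obtain ⟨z, hz⟩ := e.surjective x
  refine ⟨z, funext fun χ => ?_⟩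
  change residue0 ϖ (e z χ) = y χ
  rw [hz, hx]

theorem mem_ker_residueProd {e : Lam ϖ ≃ₐ[Ap ϖ] (Chars ϖ → Lam0 ϖ)} {x : Lam ϖ} :
    x ∈ RingHom.ker (residueProd ϖ e) ↔ ∀ χ, residue0 ϖ (e x χ) = 0 :=
  funext_iff

theorem ker_residue0_isMaximal [(pp ϖ).IsMaximal] : (RingHom.ker (residue0 ϖ)).IsMaximal := by
  let _ : Field (Kappa ϖ) := Ideal.Quotient.field (pp ϖ)
  exact RingHom.ker_isMaximal_of_surjective _ (residue_surjective _ _)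

/-- For `x` in the kernel, every component of `x * y + 1` has residue `1`, so it is a unit of the
local ring `Λ₀`. -/
theorem ker_residueProd_le_jacobson [IsLocalRing (Lam0 ϖ)] [(pp ϖ).IsMaximal]
    (e : Lam ϖ ≃ₐ[Ap ϖ] (Chars ϖ → Lam0 ϖ)) :
    RingHom.ker (residueProd ϖ e) ≤ Ideal.jacobson ⊥ := by
  intro x hx
  rw [mem_ker_residueProd] at hx
  rw [Ideal.mem_jacobson_bot]
  intro y
  rw [← isUnit_map_iff e, Pi.isUnit_iff]
  intro χ
  have h1 : residue0 ϖ (e (x * y + 1) χ) = 1 := by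
    rw [map_add, map_mul, map_one, Pi.add_apply, Pi.mul_apply, Pi.one_apply, map_add, map_mul, hx,
      zero_mul, zero_add, map_one]
  by_contra hu
  have hmax : RingHom.ker (residue0 ϖ) = IsLocalRing.maximalIdeal (Lam0 ϖ) :=
    IsLocalRing.eq_maximalIdeal ker_residue0_isMaximal
  have h2 := (IsLocalRing.mem_maximalIdeal _).2 hu
  rw [← hmax, RingHom.mem_ker, h1] at h2
  exact one_ne_zero h2

theorem ker_residueProd_mem_nhds [Finite (Chars ϖ)] {e : Lam ϖ ≃ₐ[Ap ϖ] (Chars ϖ → Lam0 ϖ)}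
    (he : Continuous e) : (RingHom.ker (residueProd ϖ e) : Set (Lam ϖ)) ∈ 𝓝 0 := by
  have h : ∀ χ, ∀ᶠ x in 𝓝 (0 : Lam ϖ), residue0 ϖ (e x χ) = 0 := by
    intro χ
    have h1 : Filter.Tendsto (fun x => e x χ) (𝓝 0) (𝓝 0) :=
      ((continuous_apply χ).comp he).tendsto' 0 0 (congrFun (map_zero e) χ)
    have h2 : ∀ᶠ y in 𝓝 (0 : Lam0 ϖ), residue0 ϖ y = 0 :=
      Filter.mem_of_superset
        ((nhds_zero_hasBasis (pp ϖ) (oneUnitFiltration (pp ϖ))).mem_of_mem (i := 1) trivial)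
        (ker_proj_le_ker_residue (pp ϖ) (oneUnitFiltration (pp ϖ)))
    exact h1.eventually h2
  exact Filter.mem_of_superset (Filter.eventually_all.2 h) fun x hx => mem_ker_residueProd.2 hx

theorem finite_quot_ker_proj {R G : Type*} [CommRing R] [CommGroup G] (I : Ideal R)
    (N : ℕ →o (Subgroup G)ᵒᵈ) [∀ m, Finite (R ⧸ I ^ m)] [∀ m, Finite (G ⧸ sub N m)] (m : ℕ) :
    Finite (Alg I N ⧸ RingHom.ker (proj I N m)) :=
  Finite.of_injective _ (RingHom.kerLift_injective _)

theorem exists_lam_algEquiv_pi [Finite (Kappa ϖ)] [∀ m, Finite (Ap ϖ ⧸ pp ϖ ^ m)]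
    [(pp ϖ).IsMaximal] {p : ℕ} (hp : p.Prime) (hpR : (p : Ap ϖ) = 0) :
    ∃ e : Lam ϖ ≃ₐ[Ap ϖ] (Chars ϖ → Lam0 ϖ), Continuous e ∧ Continuous e.symm ∧
      ∀ (ζ : (Ap ϖ)ˣ) (v : OneUnits ϖ) (χ : Chars ϖ), ζ ^ Nat.card (Kappa ϖ)ˣ = 1 →
        e (ofUnit ϖ (ζ * (v : (Ap ϖ)ˣ))) χ =
          (χ (unitReduction ϖ ζ) : Ap ϖ) • ofOneUnit ϖ v :=
  exists_algEquiv_pi (I := pp ϖ) hp hpR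

end Main

end Iwasawa

end

open Polynomial Topology Iwasawa MvPowerSeries.WithPiTopology in
set_option maxHeartbeats 1000000 in
theorem mainTheorem9 {F : Type*} [Field F] [Finite F] (ϖ : F[X]) (hmonic : ϖ.Monic)
    (hirr : Irreducible ϖ) :
    -- `Λ` is a profinite semilocal ring
    IsProfiniteRing (Lam ϖ) ∧ Finite (MaximalSpectrum (Lam ϖ)) ∧
    -- `Λ₀` is a profinite local ring with residue field `κ(𝔭)`
    IsProfiniteRing (Lam0 ϖ) ∧ IsLocalRing (Lam0 ϖ) ∧
    Function.Surjective (residue0 ϖ) ∧ (RingHom.ker (residue0 ϖ)).IsMaximal ∧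
    -- `Λ₀ ≅ A_𝔭⟦T₁, T₂, …⟧`
    (∃ f : Lam0 ϖ ≃ₐ[Ap ϖ] MvPowerSeries ℕ (Ap ϖ), Continuous f ∧ Continuous f.symm) ∧
    -- `Λ ≅ ∏_χ Λ₀`, the `χ`-component being `[ζ v] ↦ χ(ζ) [v]`
    ∃ e : Lam ϖ ≃ₐ[Ap ϖ] (Chars ϖ → Lam0 ϖ), Continuous e ∧ Continuous e.symm ∧
      (∀ (ζ : (Ap ϖ)ˣ) (v : OneUnits ϖ) (χ : Chars ϖ), ζ ^ Nat.card (Kappa ϖ)ˣ = 1 →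
        e (ofUnit ϖ (ζ * (v : (Ap ϖ)ˣ))) χ =
          (χ (unitReduction ϖ ζ) : Ap ϖ) • ofOneUnit ϖ v) ∧
      -- the chain of ideals `I_r`, cofinal among the open ideals
      ∃ I : ℕ → Ideal (Lam ϖ), Antitone I ∧
        (𝓝 (0 : Lam ϖ)).HasBasis (fun _ : ℕ => True) (fun r => (I r : Set (Lam ϖ))) ∧
        (∀ r, Finite (Lam ϖ ⧸ I r)) ∧
        I 0 = RingHom.ker (residueProd ϖ e) ∧
        -- the action of `Λ` on `I_r/I_{r+1}` factors through `Λ → ∏_χ κ(𝔭)`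
        ∀ r, QuotActsThrough (residueProd ϖ e) (I r) (I (r + 1)) := by
  obtain ⟨p, hp, hpR⟩ := exists_prime_natCast_eq_zero (ϖ := ϖ)
  have hmax := pp_isMaximal hirr
  have hfin := finite_quot hmonic
  have hfinm : ∀ m, Finite (Ap ϖ ⧸ pp ϖ ^ m) := fun m =>
    Nat.finite_of_card_ne_zero (by
      rw [card_quot_pow hirr]
      exact pow_ne_zero _ Nat.card_pos.ne')
  have hloc : IsLocalRing (Ap ϖ) := isLocalRing_of_isAdicComplete_maximal (pp ϖ)
  obtain ⟨f, hf, hf'⟩ := exists_oneUnit_algEquiv_mvPowerSeries (ap_isAdic ϖ) (pp_eq_span ϖ)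
    (card_quot_pow hirr) hp hpR
  -- Formal power series over the local ring `A_𝔭` form a local ring, and `f` transports this to
  -- `Λ₀`.
  have hloc0 : IsLocalRing (Lam0 ϖ) := f.symm.toRingEquiv.isLocalRing
  obtain ⟨e, he, he', heχ⟩ := exists_lam_algEquiv_pi (ϖ := ϖ) hp hpR
  have hchars : Finite (Chars ϖ) := finite_chars (I := pp ϖ) hp hpR
  have hjac := ker_residueProd_le_jacobson e
  obtain ⟨J, hJ, hbasis, hJfin, hJ0, hact⟩ := exists_filtration
    (ker_proj_antitone (pp ϖ) (unitFiltration (pp ϖ))) (nhds_zero_hasBasis _ _)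
    (finite_quot_ker_proj _ _) (residueProd_surjective e) (ker_residueProd_mem_nhds he) hjac
  refine ⟨alg_isProfiniteRing _ _, ?_, alg_isProfiniteRing _ _, hloc0, residue_surjective _ _,
    ker_residue0_isMaximal, ⟨f, hf, hf'⟩, e, he, he', heχ, J, hJ, hbasis, hJfin, hJ0, hact⟩
  have := hJfin 0
  exact finite_maximalSpectrum_of_le_jacobson (hJ0.trans_le hjac)
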